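/- All systems are finite-dimensional, $\log$ is to base $2$, and $U_S(t)=e^{-itH^S}$ for a system $S$ with Hamiltonian $H^S$. Let $A$ and $A'$ be quantum systems with Hamiltonians (Hermitian operators) $H^A$ and $H^{A'}$, let $\beta\in\mathbb R$ be an inverse temperature (so $\beta=1/(kT)$ at temperature $T$), and let $\gamma^S=e^{-\beta H^S}/\mathrm{Tr}\,e^{-\beta H^S}$ denote the Gibbs state of a system $S$. A linear map $\mathcal E:\mathcal B(\mathcal H_A)\to\mathcal B(\mathcal H_{A'})$ is a generalized thermal process at inverse temperature $\beta$, with energy as the only thermodynamic observable, if the following three conditions hold. (A1) There are systems $B,C$ with Hamiltonians $H^B,H^C$, a state $\sigma^B$ of $B$ and an isometry $V:\mathcal H_A\otimes\mathcal H_B\to\mathcal H_{A'}\otimes\mathcal H_C$ with $V(H^A\otimes 1+1\otimes H^B)=(H^{A'}\otimes 1+1\otimes H^C)V$ such that $\mathcal E(\rho)=\mathrm{Tr}_C\,V(\rho\otimes\sigma^B)V^\dagger$ for all $\rho$. (A2) $\mathcal E(\gamma^A)=\gamma^{A'}$. (A3) For every realization of $\mathcal E$ as in (A1), with data $B,C,H^B,H^C,\sigma^B,V$,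 there is an isometry $W:\mathcal H_A\otimes\mathcal H_B\to\mathcal H_{A'}\otimes\mathcal H_C$ with the same conservation property as $V$ such that $\mathcal E(\rho)=\mathrm{Tr}_C\,W(\rho\otimes\tilde\sigma^B)W^\dagger$ for all $\rho$, where $\tilde\sigma^B=\lim_{\tau\to\infty}\frac1\tau\int_0^\tau U_B(t)\,\sigma^B\,U_B(t)^\dagger\,dt$. For a bipartite state $\Omega$ on $RS$ the conditional min-entropy is $$H_{\min}(R|S)_\Omega=-\log\inf_{\tau^S\ge 0}\{\mathrm{Tr}\,\tau^S:\ 1^R\otimes\tau^S\ge\Omega\}.$$ For $0<q<1$, a system $R$ with Hamiltonian $H^R$, states $\eta_1,\eta_2$ of $R$ and a state $\rho$ of a system $S$ with Hamiltonian $H^S$, put $S_{\boldsymbol\eta}(\rho)=H_{\min}(R|S)_\Omega$ with $$\Omega=\big\langle q\,\eta_1\otimes\rho+(1-q)\,\eta_2\otimes\gamma^S\big\rangle,\qquad \langle\omega\rangle=\lim_{\tau\to\infty}\frac1\tau\int_0^\tau U(t)\,\omega\,U(t)^\dagger\,dt,\qquad U(t)=e^{-it(H^R\otimes 1+1\otimes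 H^S)}.$$ Theorem. Fix $q$ with $0<q<1$, and let $\rho^A$ and $\sigma^{A'}$ be states of $A$ and $A'$. There is a generalized thermal process $\mathcal E$ from $A$ to $A'$ at inverse temperature $\beta$ with $\mathcal E(\rho^A)=\sigma^{A'}$ if and only if, for every reference system $R$ of the same dimension as $A'$ with Hamiltonian $H^R=-(H^{A'})^T$ (transpose in a fixed orthonormal basis of $A'$, whose elements are identified with those of an orthonormal basis of $R$) and for all pairs of states $\boldsymbol\eta=(\eta_1,\eta_2)$ of $R$, $$S_{\boldsymbol\eta}(\rho^A)\le S_{\boldsymbol\eta}(\sigma^{A'}).$$ -/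

import Mathlib

open Matrix Filter Topology
open scoped Kronecker ComplexOrder

universe u v w

namespace QThermo

noncomputable section

/-! Finite-dimensional quantum systems. A system whose Hilbert space carries an orthonormal basis
indexed by the finite type `a` is described by the matrix algebra `Matrix a a ℂ`; the composite of
the systems indexed by `a` and `b` is indexed by `a × b`, with the Kronecker product as tensor
product. Hamiltonians need not be diagonal in the chosen basis. -/

/-- Density matrices. -/
def IsState {a : Type u} [Fintype a] (ρ : Matrix a a ℂ) : Prop :=
  ρ.PosSemidef ∧ ρ.trace = 1

/-- The total Hamiltonian `H^A ⊗ 1 + 1 ⊗ H^B` of two non-interacting systems. -/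
def jointHamiltonian {a : Type u} {b : Type v} [DecidableEq a] [DecidableEq b]
    (HA : Matrix a a ℂ) (HB : Matrix b b ℂ) : Matrix (a × b) (a × b) ℂ :=
  HA ⊗ₖ (1 : Matrix b b ℂ) + (1 : Matrix a a ℂ) ⊗ₖ HB

/-- The Gibbs state `exp (-β H) / Tr (exp (-β H))`. -/
def gibbsState {a : Type u} [Fintype a] [DecidableEq a] (β : ℝ) (H : Matrix a a ℂ) :
    Matrix a a ℂ :=
  (NormedSpace.exp ((-(β : ℂ)) • H)).trace⁻¹ • NormedSpace.exp ((-(β : ℂ)) • H)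

/-- The unitary time evolution `U(t) = exp (-i t H)`. -/
def evolution {a : Type u} [Fintype a] [DecidableEq a] (H : Matrix a a ℂ) (t : ℝ) :
    Matrix a a ℂ :=
  NormedSpace.exp ((-(Complex.I * (t : ℂ))) • H)

/-- The time average `⟨ω⟩ = lim_{τ → ∞} (1/τ) ∫_0^τ U(t) ω U(t)† dt`, entry by entry. For Hermitian
`H` the limit exists: see `tendsto_timeAverage`. -/
def timeAverage {a : Type u} [Fintype a] [DecidableEq a] (H ω : Matrix a a ℂ) : Matrix a a ℂ :=
  Matrix.of fun i j => limUnder atTop fun τ : ℝ =>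
    (τ : ℂ)⁻¹ * ∫ t in (0 : ℝ)..τ, (evolution H t * ω * (evolution H t)ᴴ) i j

/-- The partial trace over the second tensor factor. -/
def partialTraceRight {a : Type u} {c : Type v} [Fintype c] (M : Matrix (a × c) (a × c) ℂ) :
    Matrix a a ℂ :=
  Matrix.of fun i j => ∑ k, M (i, k) (j, k)

/-- The conditional min-entropy
`H_min(R|A)_Ω = - log₂ inf {Tr τ : τ ≥ 0 on A, 1 ⊗ τ ≥ Ω}`. -/
def condMinEntropy {r : Type u} {a : Type v} [Fintype r] [DecidableEq r] [Fintype a]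
    (Ω : Matrix (r × a) (r × a) ℂ) : ℝ :=
  -Real.logb 2 (sInf {x : ℝ | ∃ τ : Matrix a a ℂ, τ.PosSemidef ∧
    ((1 : Matrix r r ℂ) ⊗ₖ τ - Ω).PosSemidef ∧ x = τ.trace.re})

/-- `V : A ⊗ B → A' ⊗ C` is an isometry that conserves the total energy. -/
def IsConservingIsometry {a : Type u} {a' : Type v} {b c : Type w}
    [Fintype a] [DecidableEq a] [Fintype a'] [DecidableEq a']
    [Fintype b] [DecidableEq b] [Fintype c] [DecidableEq c]
    (HA : Matrix a a ℂ) (HA' : Matrix a' a' ℂ) (HB : Matrix b b ℂ) (HC : Matrix c c ℂ)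
    (V : Matrix (a' × c) (a × b) ℂ) : Prop :=
  Vᴴ * V = 1 ∧ V * jointHamiltonian HA HB = jointHamiltonian HA' HC * V

/-- The process `E` is realised microscopically as `E(ρ) = Tr_C V (ρ ⊗ σ) V†`, where `σ` is a state
of the environment `B`, and `V` is an isometry that conserves the total energy. -/
def IsRealisation {a : Type u} {a' : Type v} {b c : Type w}
    [Fintype a] [DecidableEq a] [Fintype a'] [DecidableEq a']
    [Fintype b] [DecidableEq b] [Fintype c] [DecidableEq c]
    (HA : Matrix a a ℂ) (HA' : Matrix a' a' ℂ) (E : Matrix a a ℂ →ₗ[ℂ] Matrix a' a' ℂ)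
    (HB : Matrix b b ℂ) (HC : Matrix c c ℂ) (σ : Matrix b b ℂ)
    (V : Matrix (a' × c) (a × b) ℂ) : Prop :=
  HB.IsHermitian ∧ HC.IsHermitian ∧ IsState σ ∧ IsConservingIsometry HA HA' HB HC V ∧
    ∀ ρ, E ρ = partialTraceRight (V * (ρ ⊗ₖ σ) * Vᴴ)

/-- Generalized thermal processes from `A` to `A'` with the Hamiltonians as the only thermodynamic
observables. (Complete positivity and trace preservation of `E` are contained in `conservation`.) -/
structure IsThermalProcess {a : Type u} {a' : Type v}
    [Fintype a] [DecidableEq a] [Fintype a'] [DecidableEq a']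
    (β : ℝ) (HA : Matrix a a ℂ) (HA' : Matrix a' a' ℂ)
    (E : Matrix a a ℂ →ₗ[ℂ] Matrix a' a' ℂ) : Prop where
  /-- Microscopic conservation: there is an energy-conserving dilation. -/
  conservation : ∃ (m k : ℕ) (HB : Matrix (Fin m) (Fin m) ℂ) (HC : Matrix (Fin k) (Fin k) ℂ)
    (σ : Matrix (Fin m) (Fin m) ℂ) (V : Matrix (a' × Fin k) (a × Fin m) ℂ),
    IsRealisation HA HA' E HB HC σ V
  /-- Equilibrium preservation. -/
  equilibrium : E (gibbsState β HA) = gibbsState β HA'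
  /-- Incoherence: in every energy-conserving dilation the state of the environment can be replaced
  by its dephased version, for a potentially different energy-conserving isometry. -/
  incoherence : ∀ (m k : ℕ) (HB : Matrix (Fin m) (Fin m) ℂ) (HC : Matrix (Fin k) (Fin k) ℂ)
    (σ : Matrix (Fin m) (Fin m) ℂ) (V : Matrix (a' × Fin k) (a × Fin m) ℂ),
    IsRealisation HA HA' E HB HC σ V →
      ∃ W : Matrix (a' × Fin k) (a × Fin m) ℂ,
        IsRealisation HA HA' E HB HC (timeAverage HB σ) W

/-- The state `ρ` of `A` can be transformed into the state `σ` of `A'` by a generalized thermal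
process. -/
def ThermallyConvertible {a : Type u} {a' : Type v}
    [Fintype a] [DecidableEq a] [Fintype a'] [DecidableEq a']
    (β : ℝ) (HA : Matrix a a ℂ) (HA' : Matrix a' a' ℂ)
    (ρ : Matrix a a ℂ) (σ : Matrix a' a' ℂ) : Prop :=
  ∃ E : Matrix a a ℂ →ₗ[ℂ] Matrix a' a' ℂ, IsThermalProcess β HA HA' E ∧ E ρ = σ

/-- `S_η(ρ) = H_min(R|A)_Ω` with `Ω = ⟨q η₁ ⊗ ρ + (1 - q) η₂ ⊗ γ⟩`, where `γ` is the Gibbs state of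
`A` and the time average is with respect to `H^R ⊗ 1 + 1 ⊗ H^A`. -/
def referenceEntropy {r : Type u} {a : Type v}
    [Fintype r] [DecidableEq r] [Fintype a] [DecidableEq a]
    (β q : ℝ) (HR : Matrix r r ℂ) (HA : Matrix a a ℂ) (η₁ η₂ : Matrix r r ℂ)
    (ρ : Matrix a a ℂ) : ℝ :=
  condMinEntropy (timeAverage (jointHamiltonian HR HA)
    ((q : ℂ) • (η₁ ⊗ₖ ρ) + (1 - (q : ℂ)) • (η₂ ⊗ₖ gibbsState β HA)))

/-! ### Existence of the time average -/

/-- Time averages of complex oscillations exist. -/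
theorem exists_mean_exp (θ : ℝ) : ∃ l : ℂ, Tendsto (fun τ : ℝ => (τ : ℂ)⁻¹ *
    ∫ t in (0 : ℝ)..τ, Complex.exp ((Complex.I * θ) * t)) atTop (𝓝 l) := by
  rcases eq_or_ne θ 0 with rfl | hθ
  · refine ⟨1, Tendsto.congr' ?_ tendsto_const_nhds⟩
    filter_upwards [eventually_gt_atTop (0 : ℝ)] with τ hτ
    have : (τ : ℂ) ≠ 0 := by exact_mod_cast hτ.ne'
    simp [this]
  · refine ⟨0, ?_⟩
    have hc : Complex.I * (θ : ℂ) ≠ 0 := mul_ne_zero Complex.I_ne_zero (by exact_mod_cast hθ)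
    rw [tendsto_zero_iff_norm_tendsto_zero]
    have hlim : Tendsto (fun τ : ℝ => τ⁻¹ * (2 / |θ|)) atTop (𝓝 0) := by
      simpa using tendsto_inv_atTop_zero.mul_const (2 / |θ|)
    refine squeeze_zero' (Eventually.of_forall fun _ => norm_nonneg _) ?_ hlim
    filter_upwards [eventually_gt_atTop (0 : ℝ)] with τ hτ
    rw [integral_exp_mul_complex hc, norm_mul, norm_inv, Complex.norm_real, Real.norm_eq_abs,
      abs_of_pos hτ, norm_div]
    have h1 : ‖Complex.exp (Complex.I * θ * τ) - Complex.exp (Complex.I * θ * (0 : ℝ))‖ ≤ 2 := by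
      refine (norm_sub_le _ _).trans ?_
      have e : Complex.I * θ * τ = ((θ * τ : ℝ) : ℂ) * Complex.I := by push_cast; ring
      rw [e, Complex.norm_exp_ofReal_mul_I]
      norm_num
    have h2 : ‖Complex.I * (θ : ℂ)‖ = |θ| := by simp
    rw [h2]
    gcongr

theorem evolution_eq {a : Type u} [Fintype a] [DecidableEq a] {H : Matrix a a ℂ}
    (hH : H.IsHermitian) (t : ℝ) :
    evolution H t = (hH.eigenvectorUnitary : Matrix a a ℂ) *
      diagonal (fun i => Complex.exp (-(Complex.I * t) * hH.eigenvalues i)) *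
      (hH.eigenvectorUnitary : Matrix a a ℂ)ᴴ := by
  have h1 : H = (hH.eigenvectorUnitary : Matrix a a ℂ) *
      diagonal (fun i => (hH.eigenvalues i : ℂ)) * (hH.eigenvectorUnitary : Matrix a a ℂ)ᴴ := by
    conv_lhs => rw [hH.spectral_theorem, Unitary.conjStarAlgAut_apply]
    rfl
  have hU : (hH.eigenvectorUnitary : Matrix a a ℂ) * (hH.eigenvectorUnitary : Matrix a a ℂ)ᴴ = 1 :=
    Unitary.mul_star_self_of_mem hH.eigenvectorUnitary.2
  have hinv : ((hH.eigenvectorUnitary : Matrix a a ℂ))⁻¹ =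
      (hH.eigenvectorUnitary : Matrix a a ℂ)ᴴ := Matrix.inv_eq_right_inv hU
  have hu : IsUnit (hH.eigenvectorUnitary : Matrix a a ℂ) :=
    (Matrix.isUnit_iff_isUnit_det _).2 (Matrix.isUnit_det_of_right_inverse hU)
  have h2 : (-(Complex.I * (t : ℂ))) • H = (hH.eigenvectorUnitary : Matrix a a ℂ) *
      diagonal (fun i => -(Complex.I * t) * (hH.eigenvalues i : ℂ)) *
      ((hH.eigenvectorUnitary : Matrix a a ℂ))⁻¹ := by
    conv_lhs => rw [h1]
    rw [hinv, ← Matrix.smul_mul, ← Matrix.mul_smul, ← Matrix.diagonal_smul]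
    rfl
  rw [evolution, h2, Matrix.exp_conj _ _ hu, Matrix.exp_diagonal, hinv]
  congr 3
  funext i
  rw [Pi.coe_exp, Complex.exp_eq_exp_ℂ]

/-- For Hermitian `H` the limit in the definition of the time average exists. -/
theorem tendsto_timeAverage {a : Type u} [Fintype a] [DecidableEq a] {H : Matrix a a ℂ}
    (hH : H.IsHermitian) (ω : Matrix a a ℂ) (i j : a) :
    Tendsto (fun τ : ℝ => (τ : ℂ)⁻¹ *
      ∫ t in (0 : ℝ)..τ, (evolution H t * ω * (evolution H t)ᴴ) i j) atTop
      (𝓝 (timeAverage H ω i j)) := by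
  refine tendsto_nhds_limUnder ?_
  set P : Matrix a a ℂ := (hH.eigenvectorUnitary : Matrix a a ℂ) with hP
  set e : a → ℝ := hH.eigenvalues with he
  have key : ∀ t : ℝ, (evolution H t * ω * (evolution H t)ᴴ) i j =
      ∑ p : a × a, (P i p.1 * (Pᴴ * ω * P) p.1 p.2 * Pᴴ p.2 j) *
        Complex.exp ((Complex.I * ((e p.2 - e p.1 : ℝ) : ℂ)) * t) := by
    intro t
    have h3 : evolution H t * ω * (evolution H t)ᴴ =
        P * (diagonal (fun i => Complex.exp (-(Complex.I * t) * e i)) * (Pᴴ * ω * P) *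
          diagonal (fun i => Complex.exp ((Complex.I * t) * e i))) * Pᴴ := by
      have hd : (diagonal (fun i => Complex.exp (-(Complex.I * t) * (e i : ℂ))))ᴴ =
          diagonal (fun i => Complex.exp ((Complex.I * t) * (e i : ℂ))) := by
        rw [Matrix.diagonal_conjTranspose]
        congr 1
        funext k
        simp [← Complex.exp_conj]
      rw [evolution_eq hH t, Matrix.conjTranspose_mul, Matrix.conjTranspose_mul,
        Matrix.conjTranspose_conjTranspose, hd]
      simp only [Matrix.mul_assoc, hP, he]
    rw [h3, Matrix.mul_apply, Fintype.sum_prod_type_right]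
    refine Finset.sum_congr rfl fun l _ => ?_
    rw [Matrix.mul_apply, Finset.sum_mul]
    refine Finset.sum_congr rfl fun k _ => ?_
    rw [Matrix.mul_diagonal, Matrix.diagonal_mul]
    have : Complex.exp ((Complex.I * ((e l - e k : ℝ) : ℂ)) * t) =
        Complex.exp (-(Complex.I * t) * e k) * Complex.exp ((Complex.I * t) * e l) := by
      rw [← Complex.exp_add]
      congr 1
      push_cast
      ring
    rw [this]
    ring
  choose l hl using exists_mean_exp
  refine ⟨∑ p : a × a, (P i p.1 * (Pᴴ * ω * P) p.1 p.2 * Pᴴ p.2 j) * l (e p.2 - e p.1), ?_⟩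
  have hfun : (fun τ : ℝ => (τ : ℂ)⁻¹ *
      ∫ t in (0 : ℝ)..τ, (evolution H t * ω * (evolution H t)ᴴ) i j) =
      fun τ : ℝ => ∑ p : a × a, (P i p.1 * (Pᴴ * ω * P) p.1 p.2 * Pᴴ p.2 j) *
        ((τ : ℂ)⁻¹ * ∫ t in (0 : ℝ)..τ,
          Complex.exp ((Complex.I * ((e p.2 - e p.1 : ℝ) : ℂ)) * t)) := by
    funext τ
    simp only [key]
    rw [intervalIntegral.integral_finsetSum]
    · rw [Finset.mul_sum]
      refine Finset.sum_congr rfl fun p _ => ?_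
      rw [intervalIntegral.integral_const_mul]
      ring
    · intro p _
      exact Continuous.intervalIntegrable (by fun_prop) _ _
  rw [hfun]
  exact tendsto_finsetSum _ fun p _ => (hl _).const_mul _

end

end QThermo

namespace QThermo

noncomputable section

/-! ### The time average as a projection -/

/-! Incoherence amounts to covariance under time evolution. A dephased environment commutes with its
Hamiltonian, so the process it drives is covariant (`IsRealisation.isCovariant`). Conversely, in any
dilation of a covariant process the environment can be dephased while the isometry stays the same
(`IsRealisation.timeAverage`). A positive `N` that commutes with `K = -HA'ᵀ ⊗ 1 + 1 ⊗ HA` and has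
`Tr_{A'} N = 1` yields a conserving dilation through its square root
(`isThermalProcess_ofChoiMatrix`). Convertibility is thereby the feasibility of a semidefinite
program: find such an `N` whose map sends `ρ` to `σ` and Gibbs state to Gibbs state.

Necessity is data processing: for a covariant `E`, the map `id ⊗ E` is positive and commutes with
time averaging, so it carries a feasible `τ` for the input to the feasible `E τ`, of the same trace.

Sufficiency is duality. If the program is infeasible, Hahn-Banach gives Hermitian `Z, X₁, X₂` that
separate (`exists_dual_witness`). Adding multiples of the identity and rescaling turns `X₁ᵀ, X₂ᵀ`
into states with weights `q` and `1 - q`, and `Z` into an upper bound for the infimum at `ρ`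
(`trace_mem_feasibleTraces`). The unnormalised maximally entangled vector gives a lower bound for
the infimum at `σ` (`re_trace_entangledMatrix_mul_le`). The entropy inequality for this one pair
compares the two bounds the wrong way round for a strict separation. The choice `HR = -HA'ᵀ` is what
makes the entangled projection stationary.

The time average enters only algebraically: it is the projection onto the commutant of `H` along the
commutators with `H`. -/

theorem tendsto_mean_exp (θ : ℝ) : Tendsto (fun τ : ℝ => (τ : ℂ)⁻¹ *
    ∫ t in (0 : ℝ)..τ, Complex.exp ((Complex.I * θ) * t)) atTop (𝓝 (if θ = 0 then 1 else 0)) := by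
  split_ifs with hθ
  · subst hθ
    refine Tendsto.congr' ?_ tendsto_const_nhds
    filter_upwards [eventually_gt_atTop (0 : ℝ)] with τ hτ
    have : (τ : ℂ) ≠ 0 := by exact_mod_cast hτ.ne'
    simp [this]
  · have hc : Complex.I * (θ : ℂ) ≠ 0 := mul_ne_zero Complex.I_ne_zero (by exact_mod_cast hθ)
    rw [tendsto_zero_iff_norm_tendsto_zero]
    have hlim : Tendsto (fun τ : ℝ => τ⁻¹ * (2 / |θ|)) atTop (𝓝 0) := by
      simpa using tendsto_inv_atTop_zero.mul_const (2 / |θ|)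
    refine squeeze_zero' (Eventually.of_forall fun _ => norm_nonneg _) ?_ hlim
    filter_upwards [eventually_gt_atTop (0 : ℝ)] with τ hτ
    rw [integral_exp_mul_complex hc, norm_mul, norm_inv, Complex.norm_real, Real.norm_eq_abs,
      abs_of_pos hτ, norm_div]
    have h1 : ‖Complex.exp (Complex.I * θ * τ) - Complex.exp (Complex.I * θ * (0 : ℝ))‖ ≤ 2 := by
      refine (norm_sub_le _ _).trans ?_
      have e : Complex.I * θ * τ = ((θ * τ : ℝ) : ℂ) * Complex.I := by push_cast; ring
      rw [e, Complex.norm_exp_ofReal_mul_I]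
      norm_num
    have h2 : ‖Complex.I * (θ : ℂ)‖ = |θ| := by simp
    rw [h2]
    gcongr

section TimeAverage

variable {a : Type u} [Fintype a] [DecidableEq a] {H : Matrix a a ℂ}

/-- In an eigenbasis of `H`, the time average deletes the entries between different energies. -/
theorem timeAverage_eq (hH : H.IsHermitian) (ω : Matrix a a ℂ) :
    timeAverage H ω = (hH.eigenvectorUnitary : Matrix a a ℂ) *
      Matrix.of (fun k l => if hH.eigenvalues k = hH.eigenvalues l then
        ((hH.eigenvectorUnitary : Matrix a a ℂ)ᴴ * ω *
          (hH.eigenvectorUnitary : Matrix a a ℂ)) k l else 0) *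
      (hH.eigenvectorUnitary : Matrix a a ℂ)ᴴ := by
  ext i j
  refine tendsto_nhds_unique (tendsto_timeAverage hH ω i j) ?_
  set P : Matrix a a ℂ := (hH.eigenvectorUnitary : Matrix a a ℂ) with hP
  set e : a → ℝ := hH.eigenvalues with he
  have key : ∀ t : ℝ, (evolution H t * ω * (evolution H t)ᴴ) i j =
      ∑ p : a × a, (P i p.1 * (Pᴴ * ω * P) p.1 p.2 * Pᴴ p.2 j) *
        Complex.exp ((Complex.I * ((e p.2 - e p.1 : ℝ) : ℂ)) * t) := by
    intro t
    have h3 : evolution H t * ω * (evolution H t)ᴴ =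
        P * (diagonal (fun i => Complex.exp (-(Complex.I * t) * e i)) * (Pᴴ * ω * P) *
          diagonal (fun i => Complex.exp ((Complex.I * t) * e i))) * Pᴴ := by
      have hd : (diagonal (fun i => Complex.exp (-(Complex.I * t) * (e i : ℂ))))ᴴ =
          diagonal (fun i => Complex.exp ((Complex.I * t) * (e i : ℂ))) := by
        rw [Matrix.diagonal_conjTranspose]
        congr 1
        funext k
        simp [← Complex.exp_conj]
      rw [evolution_eq hH t, Matrix.conjTranspose_mul, Matrix.conjTranspose_mul,
        Matrix.conjTranspose_conjTranspose, hd]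
      simp only [Matrix.mul_assoc, hP, he]
    rw [h3, Matrix.mul_apply, Fintype.sum_prod_type_right]
    refine Finset.sum_congr rfl fun l _ => ?_
    rw [Matrix.mul_apply, Finset.sum_mul]
    refine Finset.sum_congr rfl fun k _ => ?_
    rw [Matrix.mul_diagonal, Matrix.diagonal_mul]
    have : Complex.exp ((Complex.I * ((e l - e k : ℝ) : ℂ)) * t) =
        Complex.exp (-(Complex.I * t) * e k) * Complex.exp ((Complex.I * t) * e l) := by
      rw [← Complex.exp_add]
      congr 1
      push_cast
      ring
    rw [this]
    ring
  have hfun : (fun τ : ℝ => (τ : ℂ)⁻¹ *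
      ∫ t in (0 : ℝ)..τ, (evolution H t * ω * (evolution H t)ᴴ) i j) =
      fun τ : ℝ => ∑ p : a × a, (P i p.1 * (Pᴴ * ω * P) p.1 p.2 * Pᴴ p.2 j) *
        ((τ : ℂ)⁻¹ * ∫ t in (0 : ℝ)..τ,
          Complex.exp ((Complex.I * ((e p.2 - e p.1 : ℝ) : ℂ)) * t)) := by
    funext τ
    simp only [key]
    rw [intervalIntegral.integral_finsetSum]
    · rw [Finset.mul_sum]
      refine Finset.sum_congr rfl fun p _ => ?_
      rw [intervalIntegral.integral_const_mul]
      ring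
    · intro p _
      exact Continuous.intervalIntegrable (by fun_prop) _ _
  have hval : (P * Matrix.of (fun k l => if e k = e l then (Pᴴ * ω * P) k l else 0) * Pᴴ) i j =
      ∑ p : a × a, (P i p.1 * (Pᴴ * ω * P) p.1 p.2 * Pᴴ p.2 j) *
        (if e p.2 - e p.1 = 0 then 1 else 0) := by
    rw [Matrix.mul_apply, Fintype.sum_prod_type_right]
    refine Finset.sum_congr rfl fun l _ => ?_
    rw [Matrix.mul_apply, Finset.sum_mul]
    refine Finset.sum_congr rfl fun k _ => ?_
    by_cases h : e k = e l
    · simp [h]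
    · simp [h, sub_eq_zero, Ne.symm h]
  rw [hfun, hval]
  exact tendsto_finsetSum _ fun p _ => (tendsto_mean_exp _).const_mul _

theorem eigenvectorUnitary_conj (hH : H.IsHermitian) :
    H = (hH.eigenvectorUnitary : Matrix a a ℂ) *
      diagonal (fun i => (hH.eigenvalues i : ℂ)) * (hH.eigenvectorUnitary : Matrix a a ℂ)ᴴ := by
  conv_lhs => rw [hH.spectral_theorem, Unitary.conjStarAlgAut_apply]
  rfl

/-- A commutator with `H` that commutes with the Hermitian matrix `H` vanishes. -/
theorem eq_zero_of_commutator {a : Type u} [Fintype a] {H : Matrix a a ℂ} (hH : H.IsHermitian)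
    {X Y : Matrix a a ℂ} (h1 : H * X = X * H)
    (h2 : X = H * Y - Y * H) : X = 0 := by
  rw [← Matrix.trace_conjTranspose_mul_self_eq_zero_iff]
  have h3 : Xᴴ * H = H * Xᴴ := by
    have := congrArg conjTranspose h1
    rwa [conjTranspose_mul, conjTranspose_mul, hH.eq] at this
  nth_rw 2 [h2]
  rw [mul_sub, trace_sub, ← Matrix.mul_assoc, h3, Matrix.mul_assoc, ← Matrix.mul_assoc Xᴴ,
    trace_mul_comm H, sub_self]

theorem timeAverage_commute (hH : H.IsHermitian) (ω : Matrix a a ℂ) :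
    H * timeAverage H ω = timeAverage H ω * H := by
  have hU : (hH.eigenvectorUnitary : Matrix a a ℂ)ᴴ * (hH.eigenvectorUnitary : Matrix a a ℂ) = 1 :=
    Unitary.star_mul_self_of_mem hH.eigenvectorUnitary.2
  rw [timeAverage_eq hH]
  set P : Matrix a a ℂ := (hH.eigenvectorUnitary : Matrix a a ℂ) with hP
  set B := Matrix.of (fun k l => if hH.eigenvalues k = hH.eigenvalues l then
    (Pᴴ * ω * P) k l else 0) with hB
  have hc : diagonal (fun i => (hH.eigenvalues i : ℂ)) * B =
      B * diagonal (fun i => (hH.eigenvalues i : ℂ)) := by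
    ext k l
    rw [diagonal_mul, mul_diagonal, hB, of_apply]
    split_ifs with h
    · rw [h, mul_comm]
    · simp
  have hH' := eigenvectorUnitary_conj hH
  rw [← hP] at hH'
  set D := diagonal (fun i => (hH.eigenvalues i : ℂ)) with hD
  calc H * (P * B * Pᴴ) = P * D * (Pᴴ * P) * B * Pᴴ := by
        conv_lhs => rw [hH']
        simp only [Matrix.mul_assoc]
    _ = P * (D * B) * Pᴴ := by rw [hU]; simp only [Matrix.mul_assoc, Matrix.one_mul]
    _ = P * B * (Pᴴ * P) * D * Pᴴ := by
        rw [hc, hU]; simp only [Matrix.mul_assoc, Matrix.one_mul]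
    _ = P * B * Pᴴ * H := by
        conv_rhs => rw [hH']
        simp only [Matrix.mul_assoc]

/-- In an eigenbasis, a commutator with `H` multiplies the entry `(k, l)` by the energy gap. The
deleted entries are exactly those with nonzero gap, so division by the gap solves the equation. -/
theorem exists_sub_timeAverage (hH : H.IsHermitian) (ω : Matrix a a ℂ) :
    ∃ Y, ω - timeAverage H ω = H * Y - Y * H := by
  have hU : (hH.eigenvectorUnitary : Matrix a a ℂ)ᴴ * (hH.eigenvectorUnitary : Matrix a a ℂ) = 1 :=
    Unitary.star_mul_self_of_mem hH.eigenvectorUnitary.2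
  have hU' : (hH.eigenvectorUnitary : Matrix a a ℂ) * (hH.eigenvectorUnitary : Matrix a a ℂ)ᴴ = 1 :=
    Unitary.mul_star_self_of_mem hH.eigenvectorUnitary.2
  rw [timeAverage_eq hH]
  set P : Matrix a a ℂ := (hH.eigenvectorUnitary : Matrix a a ℂ) with hP
  set B := Matrix.of (fun k l => if hH.eigenvalues k = hH.eigenvalues l then
    (Pᴴ * ω * P) k l else 0) with hB
  have hH' := eigenvectorUnitary_conj hH
  rw [← hP] at hH'
  set D := diagonal (fun i => (hH.eigenvalues i : ℂ)) with hD
  -- At zero gap the quotient is `0` by convention; its value is irrelevant there, since the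
  -- commutator vanishes anyway.
  set C : Matrix a a ℂ := Matrix.of (fun k l =>
    (Pᴴ * ω * P) k l / ((hH.eigenvalues k : ℂ) - hH.eigenvalues l)) with hC
  have hc : Pᴴ * ω * P - B = D * C - C * D := by
    ext k l
    rw [Matrix.sub_apply, Matrix.sub_apply, hD, diagonal_mul, mul_diagonal, hB, of_apply, hC,
      of_apply]
    split_ifs with h
    · simp [h]
    · have : (hH.eigenvalues k : ℂ) - hH.eigenvalues l ≠ 0 := by
        rw [sub_ne_zero]
        exact_mod_cast h
      field_simp
      ring
  refine ⟨P * C * Pᴴ, ?_⟩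
  calc ω - P * B * Pᴴ = (P * Pᴴ) * ω * (P * Pᴴ) - P * B * Pᴴ := by
        rw [hU', Matrix.one_mul, Matrix.mul_one]
    _ = P * (Pᴴ * ω * P - B) * Pᴴ := by
        simp only [Matrix.mul_sub, Matrix.sub_mul, Matrix.mul_assoc]
    _ = P * D * (Pᴴ * P) * C * Pᴴ - P * C * (Pᴴ * P) * D * Pᴴ := by
        rw [hc, hU]
        simp only [Matrix.mul_sub, Matrix.sub_mul, Matrix.mul_assoc, Matrix.one_mul]
    _ = H * (P * C * Pᴴ) - P * C * Pᴴ * H := by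
        conv_rhs => rw [hH']
        simp only [Matrix.mul_assoc]

/-- The time average of `ω` is the component of `ω` that commutes with `H`, along the space of
commutators with `H`. -/
theorem timeAverage_unique (hH : H.IsHermitian) {ω X Y : Matrix a a ℂ} (h1 : H * X = X * H)
    (h2 : ω - X = H * Y - Y * H) : timeAverage H ω = X := by
  obtain ⟨Z, hZ⟩ := exists_sub_timeAverage hH ω
  rw [← sub_eq_zero]
  refine eq_zero_of_commutator hH (Y := Y - Z) ?_ ?_
  · rw [mul_sub, sub_mul, timeAverage_commute hH, h1]
  · have : timeAverage H ω - X = (ω - X) - (ω - timeAverage H ω) := by abel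
    rw [this, h2, hZ]
    noncomm_ring

theorem timeAverage_of_commute (hH : H.IsHermitian) {X : Matrix a a ℂ} (h : H * X = X * H) :
    timeAverage H X = X :=
  timeAverage_unique hH (Y := 0) h (by simp)

/-- Linear maps that intertwine the commutators with two Hamiltonians intertwine the time
averages. -/
theorem map_timeAverage {b : Type v} [Fintype b] [DecidableEq b] {H' : Matrix b b ℂ}
    (hH : H.IsHermitian) (hH' : H'.IsHermitian) (L : Matrix a a ℂ →ₗ[ℂ] Matrix b b ℂ)
    (hL : ∀ Y, L (H * Y - Y * H) = H' * L Y - L Y * H') (ω : Matrix a a ℂ) :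
    L (timeAverage H ω) = timeAverage H' (L ω) := by
  obtain ⟨Z, hZ⟩ := exists_sub_timeAverage hH ω
  symm
  refine timeAverage_unique hH' (Y := L Z) ?_ ?_
  · rw [← sub_eq_zero, ← hL, timeAverage_commute hH, sub_self, map_zero]
  · rw [← map_sub, hZ, hL]

/-- By cyclicity of the trace, anything that commutes with `H` is orthogonal to all commutators with
`H`. -/
theorem trace_mul_timeAverage (hH : H.IsHermitian) {J : Matrix a a ℂ} (hJ : H * J = J * H)
    (ω : Matrix a a ℂ) : (J * timeAverage H ω).trace = (J * ω).trace := by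
  obtain ⟨Z, hZ⟩ := exists_sub_timeAverage hH ω
  rw [eq_comm, ← sub_eq_zero, ← trace_sub, ← mul_sub, hZ, mul_sub, trace_sub, ← Matrix.mul_assoc,
    ← hJ, Matrix.mul_assoc, ← Matrix.mul_assoc J, trace_mul_comm H, sub_self]

theorem trace_timeAverage (hH : H.IsHermitian) (ω : Matrix a a ℂ) :
    (timeAverage H ω).trace = ω.trace := by
  simpa using trace_mul_timeAverage hH (J := 1) (by simp) ω

theorem trace_mul_timeAverage_comm (hH : H.IsHermitian) (J ω : Matrix a a ℂ) :
    (J * timeAverage H ω).trace = (timeAverage H J * ω).trace := by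
  rw [← trace_mul_timeAverage hH (timeAverage_commute hH J), trace_mul_comm (timeAverage H J),
    trace_mul_timeAverage hH (timeAverage_commute hH ω), trace_mul_comm]

theorem timeAverage_posSemidef (hH : H.IsHermitian) {ω : Matrix a a ℂ} (hω : ω.PosSemidef) :
    (timeAverage H ω).PosSemidef := by
  rw [timeAverage_eq hH]
  set P : Matrix a a ℂ := (hH.eigenvectorUnitary : Matrix a a ℂ) with hP
  refine PosSemidef.mul_mul_conjTranspose_same ?_ P
  -- Averaging is a Schur product with the 0/1 matrix of equal energies. That matrix is the identity
  -- indexed by all real energies, pulled back along the eigenvalues, hence positive; the Schur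
  -- product theorem finishes.
  have h1 : ((1 : Matrix ℝ ℝ ℂ).submatrix hH.eigenvalues hH.eigenvalues).PosSemidef :=
    PosSemidef.one.submatrix _
  have h2 : Matrix.of (fun k l => if hH.eigenvalues k = hH.eigenvalues l then
      (Pᴴ * ω * P) k l else 0) =
      (1 : Matrix ℝ ℝ ℂ).submatrix hH.eigenvalues hH.eigenvalues ⊙ (Pᴴ * ω * P) := by
    ext k l
    simp [Matrix.one_apply]
  rw [h2]
  exact h1.hadamard (hω.conjTranspose_mul_mul_same P)

theorem timeAverage_isState (hH : H.IsHermitian) {ω : Matrix a a ℂ} (hω : IsState ω) :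
    IsState (timeAverage H ω) :=
  ⟨timeAverage_posSemidef hH hω.1, (trace_timeAverage hH ω).trans hω.2⟩

theorem timeAverage_sub (hH : H.IsHermitian) (ω ω' : Matrix a a ℂ) :
    timeAverage H (ω - ω') = timeAverage H ω - timeAverage H ω' := by
  obtain ⟨Y, hY⟩ := exists_sub_timeAverage hH ω
  obtain ⟨Z, hZ⟩ := exists_sub_timeAverage hH ω'
  refine timeAverage_unique hH (Y := Y - Z) ?_ ?_
  · rw [mul_sub, sub_mul, timeAverage_commute hH, timeAverage_commute hH]
  · rw [sub_sub_sub_comm, hY, hZ]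
    noncomm_ring

end TimeAverage

/-! ### Gibbs states -/

theorem gibbsState_isState {a : Type u} [Fintype a] [DecidableEq a] [Nonempty a] (β : ℝ)
    {H : Matrix a a ℂ} (hH : H.IsHermitian) : IsState (gibbsState β H) := by
  -- Half the exponent, so that the Boltzmann operator is `(exp X)† (exp X)` with `exp X`
  -- invertible.
  set X : Matrix a a ℂ := (-((β / 2 : ℝ) : ℂ)) • H with hX
  have hXH : X.IsHermitian := by
    rw [IsHermitian, hX, conjTranspose_smul, hH.eq]
    congr 1
    simp
  have h1 : NormedSpace.exp ((-(β : ℂ)) • H) =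
      (NormedSpace.exp X)ᴴ * NormedSpace.exp X := by
    rw [← Matrix.exp_conjTranspose, hXH.eq, ← Matrix.exp_add_of_commute _ _ (Commute.refl X), hX,
      ← add_smul]
    congr 2
    push_cast
    ring
  have h2 : (NormedSpace.exp ((-(β : ℂ)) • H)).PosDef := by
    rw [h1]
    exact PosDef.conjTranspose_mul_self _
      (Matrix.mulVec_injective_of_isUnit (Matrix.isUnit_exp X))
  have h3 : 0 < (NormedSpace.exp ((-(β : ℂ)) • H)).trace := h2.trace_pos
  refine ⟨h2.posSemidef.smul (inv_nonneg.2 h3.le), ?_⟩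
  rw [gibbsState, trace_smul, smul_eq_mul, inv_mul_cancel₀ h3.ne']

section Covariance

variable {a : Type u} {a' : Type v} {b c : Type w}
  [Fintype a] [DecidableEq a] [Fintype a'] [DecidableEq a']
  [Fintype b] [DecidableEq b] [Fintype c] [DecidableEq c]
  {HA : Matrix a a ℂ} {HA' : Matrix a' a' ℂ} {HB : Matrix b b ℂ} {HC : Matrix c c ℂ}

/-! ### Covariant linear maps -/

/-- `E` is covariant with respect to the time evolutions generated by `HA` and `HA'`; this is the
infinitesimal form of `E (U_A(t) X U_A(t)†) = U_{A'}(t) E(X) U_{A'}(t)†`. -/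
def IsCovariant (HA : Matrix a a ℂ) (HA' : Matrix a' a' ℂ)
    (E : Matrix a a ℂ →ₗ[ℂ] Matrix a' a' ℂ) : Prop :=
  ∀ X, E (HA * X - X * HA) = HA' * E X - E X * HA'

omit [Fintype a] [Fintype b] in
theorem jointHamiltonian_isHermitian (hHA : HA.IsHermitian) (hHB : HB.IsHermitian) :
    (jointHamiltonian HA HB).IsHermitian := by
  rw [IsHermitian, jointHamiltonian, conjTranspose_add, conjTranspose_kronecker,
    conjTranspose_kronecker, hHA.eq, hHB.eq, conjTranspose_one, conjTranspose_one]

theorem jointHamiltonian_commutator_kronecker (HA : Matrix a a ℂ) (HB : Matrix b b ℂ)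
    (X : Matrix a a ℂ) (Y : Matrix b b ℂ) :
    jointHamiltonian HA HB * (X ⊗ₖ Y) - (X ⊗ₖ Y) * jointHamiltonian HA HB =
      (HA * X - X * HA) ⊗ₖ Y + X ⊗ₖ (HB * Y - Y * HB) := by
  simp only [jointHamiltonian, add_mul, mul_add, ← mul_kronecker_mul, Matrix.one_mul,
    Matrix.mul_one]
  ext ⟨i, k⟩ ⟨j, l⟩
  simp only [Matrix.add_apply, Matrix.sub_apply, kroneckerMap_apply]
  ring

theorem jointHamiltonian_mul_apply (HA : Matrix a a ℂ) (HC : Matrix c c ℂ) {d : Type*}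
    (M : Matrix (a × c) d ℂ) (x : a) (k : c) (q : d) :
    (jointHamiltonian HA HC * M) (x, k) q =
      ∑ z, HA x z * M (z, k) q + ∑ l, HC k l * M (x, l) q := by
  simp [jointHamiltonian, Matrix.mul_apply, Fintype.sum_prod_type, Matrix.one_apply, add_mul,
    Finset.sum_add_distrib]

theorem mul_jointHamiltonian_apply (HA : Matrix a a ℂ) (HC : Matrix c c ℂ) {d : Type*}
    (M : Matrix d (a × c) ℂ) (q : d) (x : a) (k : c) :
    (M * jointHamiltonian HA HC) q (x, k) =
      ∑ z, M q (z, k) * HA z x + ∑ l, M q (x, l) * HC l k := by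
  simp [jointHamiltonian, Matrix.mul_apply, Fintype.sum_prod_type, Matrix.one_apply, mul_add,
    Finset.sum_add_distrib]

/-- The partial trace is cyclic for operators on `C`, so the contribution of `HC` cancels. -/
theorem partialTraceRight_commutator (HA' : Matrix a' a' ℂ) (HC : Matrix c c ℂ)
    (M : Matrix (a' × c) (a' × c) ℂ) :
    partialTraceRight (jointHamiltonian HA' HC * M - M * jointHamiltonian HA' HC) =
      HA' * partialTraceRight M - partialTraceRight M * HA' := by
  ext i j
  simp only [partialTraceRight, of_apply, Matrix.sub_apply, jointHamiltonian_mul_apply,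
    mul_jointHamiltonian_apply, Finset.sum_sub_distrib, Finset.sum_add_distrib]
  simp only [Matrix.mul_apply, of_apply, Finset.mul_sum, Finset.sum_mul]
  rw [Finset.sum_comm (f := fun k l => HC k l * M (i, l) (j, k)),
    Finset.sum_comm (f := fun k z => HA' i z * M (z, k) (j, k)),
    Finset.sum_comm (f := fun k z => M (i, k) (z, k) * HA' z j)]
  simp only [mul_comm (HC _ _)]
  ring

theorem IsConservingIsometry.conj_commutator {V : Matrix (a' × c) (a × b) ℂ}
    (hHA : HA.IsHermitian) (hHA' : HA'.IsHermitian) (hHB : HB.IsHermitian) (hHC : HC.IsHermitian)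
    (hV : IsConservingIsometry HA HA' HB HC V) (Z : Matrix (a × b) (a × b) ℂ) :
    V * (jointHamiltonian HA HB * Z - Z * jointHamiltonian HA HB) * Vᴴ =
      jointHamiltonian HA' HC * (V * Z * Vᴴ) - (V * Z * Vᴴ) * jointHamiltonian HA' HC := by
  have h1 := congrArg conjTranspose hV.2
  rw [conjTranspose_mul, conjTranspose_mul, (jointHamiltonian_isHermitian hHA hHB).eq,
    (jointHamiltonian_isHermitian hHA' hHC).eq] at h1
  rw [Matrix.mul_sub, Matrix.sub_mul, ← Matrix.mul_assoc V, hV.2]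
  simp only [Matrix.mul_assoc]
  rw [h1]

/-- The map `(X, Y) ↦ Tr_C V (X ⊗ Y) V†`. -/
def dilationMap (V : Matrix (a' × c) (a × b) ℂ) :
    Matrix a a ℂ →ₗ[ℂ] Matrix b b ℂ →ₗ[ℂ] Matrix a' a' ℂ :=
  LinearMap.mk₂ ℂ (fun X Y => partialTraceRight (V * (X ⊗ₖ Y) * Vᴴ))
    (fun X X' Y => by
      ext; simp [partialTraceRight, add_kronecker, Matrix.mul_add, Matrix.add_mul,
        Finset.sum_add_distrib])
    (fun r X Y => by
      ext; simp [partialTraceRight, smul_kronecker, Finset.mul_sum])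
    (fun X Y Y' => by
      ext; simp [partialTraceRight, kronecker_add, Matrix.mul_add, Matrix.add_mul,
        Finset.sum_add_distrib])
    (fun r X Y => by
      ext; simp [partialTraceRight, kronecker_smul, Finset.mul_sum])

omit [DecidableEq a] [DecidableEq a'] [DecidableEq b] [DecidableEq c] [Fintype a'] in
theorem dilationMap_apply (V : Matrix (a' × c) (a × b) ℂ) (X : Matrix a a ℂ) (Y : Matrix b b ℂ) :
    dilationMap V X Y = partialTraceRight (V * (X ⊗ₖ Y) * Vᴴ) := rfl

/-- A Leibniz rule: energy conservation makes the dilation jointly covariant in system and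
environment. If `Y` commutes with `HB` the second term drops out, which leaves covariance in `X`
alone. -/
theorem IsConservingIsometry.dilationMap_commutator {V : Matrix (a' × c) (a × b) ℂ}
    (hHA : HA.IsHermitian) (hHA' : HA'.IsHermitian) (hHB : HB.IsHermitian) (hHC : HC.IsHermitian)
    (hV : IsConservingIsometry HA HA' HB HC V) (X : Matrix a a ℂ) (Y : Matrix b b ℂ) :
    dilationMap V (HA * X - X * HA) Y + dilationMap V X (HB * Y - Y * HB) =
      HA' * dilationMap V X Y - dilationMap V X Y * HA' := by
  simp only [dilationMap_apply]
  rw [← partialTraceRight_commutator HA' HC, ← hV.conj_commutator hHA hHA' hHB hHC,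
    jointHamiltonian_commutator_kronecker]
  ext
  simp [partialTraceRight, Matrix.mul_add, Matrix.add_mul, Finset.sum_add_distrib]

theorem IsRealisation.eq_dilationMap {E : Matrix a a ℂ →ₗ[ℂ] Matrix a' a' ℂ} {σ : Matrix b b ℂ}
    {V : Matrix (a' × c) (a × b) ℂ} (h : IsRealisation HA HA' E HB HC σ V) :
    E = (dilationMap V).flip σ :=
  LinearMap.ext h.2.2.2.2

theorem IsRealisation.isCovariant {E : Matrix a a ℂ →ₗ[ℂ] Matrix a' a' ℂ} {σ : Matrix b b ℂ}
    {V : Matrix (a' × c) (a × b) ℂ} (hHA : HA.IsHermitian) (hHA' : HA'.IsHermitian)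
    (h : IsRealisation HA HA' E HB HC σ V) (hσ : HB * σ = σ * HB) : IsCovariant HA HA' E := by
  intro X
  have := h.2.2.2.1.dilationMap_commutator hHA hHA' h.1 h.2.1 X σ
  rw [hσ, sub_self, map_zero, add_zero] at this
  rw [h.eq_dilationMap]
  exact this

/-! ### Choi matrices -/

/-- The Choi matrix of `E`, transposed, as a linear function of `E`. -/
def choiMatrix : (Matrix a a ℂ →ₗ[ℂ] Matrix a' a' ℂ) →ₗ[ℂ] Matrix (a' × a) (a' × a) ℂ where
  toFun E := Matrix.of fun p q => E (Matrix.single q.2 p.2 1) q.1 p.1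
  map_add' _ _ := rfl
  map_smul' _ _ := rfl

omit [Fintype a] [Fintype a'] [DecidableEq a'] in
theorem choiMatrix_apply (E : Matrix a a ℂ →ₗ[ℂ] Matrix a' a' ℂ) (x y : a') (i j : a) :
    choiMatrix E (x, i) (y, j) = E (Matrix.single j i 1) y x := rfl

omit [Fintype a'] [DecidableEq a'] in
theorem choiMatrix_injective : Function.Injective
    (choiMatrix : (Matrix a a ℂ →ₗ[ℂ] Matrix a' a' ℂ) →ₗ[ℂ] Matrix (a' × a) (a' × a) ℂ) := by
  intro E F h
  refine Matrix.ext_linearMap _ fun i j => LinearMap.ext_ring ?_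
  ext y x
  exact congrFun (congrFun h (x, j)) (y, i)

/-- The failure of `E` to be covariant is the commutator of its Choi matrix with the joint
Hamiltonian. The output index enters transposed and on the opposite side, hence `-HA'ᵀ`. With `F =
0` this says that covariance of `E` makes its Choi matrix stationary. -/
theorem choiMatrix_commutator (HA : Matrix a a ℂ) (HA' : Matrix a' a' ℂ)
    (E F : Matrix a a ℂ →ₗ[ℂ] Matrix a' a' ℂ)
    (h : ∀ X, F X = HA' * E X - E X * HA' - E (HA * X - X * HA)) :
    choiMatrix F = jointHamiltonian (-HA'ᵀ) HA * choiMatrix E -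
      choiMatrix E * jointHamiltonian (-HA'ᵀ) HA := by
  ext ⟨x, i⟩ ⟨y, j⟩
  have h1 : HA * Matrix.single j i 1 = ∑ l, HA l j • Matrix.single l i (1 : ℂ) := by
    ext p q
    simp [Matrix.mul_apply, Matrix.sum_apply, Matrix.single_apply]
    simp [ite_and]
  have h2 : Matrix.single j i 1 * HA = ∑ l, HA i l • Matrix.single j l (1 : ℂ) := by
    ext p q
    simp [Matrix.mul_apply, Matrix.sum_apply, Matrix.single_apply]
    simp [ite_and]
  rw [Matrix.sub_apply, jointHamiltonian_mul_apply, mul_jointHamiltonian_apply]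
  simp only [choiMatrix_apply, h, map_sub, h1, h2, map_sum, map_smul, Matrix.sub_apply,
    Matrix.sum_apply, Matrix.smul_apply, smul_eq_mul, Matrix.mul_apply, Matrix.neg_apply,
    transpose_apply, neg_mul, mul_neg, Finset.sum_neg_distrib]
  simp only [mul_comm (HA _ _), mul_comm (HA' _ _)]
  ring

/-- The environment of a covariant process may be dephased without changing the isometry. -/
theorem IsRealisation.timeAverage {E : Matrix a a ℂ →ₗ[ℂ] Matrix a' a' ℂ} {σ : Matrix b b ℂ}
    {V : Matrix (a' × c) (a × b) ℂ} (hHA : HA.IsHermitian) (hHA' : HA'.IsHermitian)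
    (h : IsRealisation HA HA' E HB HC σ V) (hE : IsCovariant HA HA' E) :
    IsRealisation HA HA' E HB HC (timeAverage HB σ) V := by
  refine ⟨h.1, h.2.1, timeAverage_isState h.1 h.2.2.1, h.2.2.2.1, fun X => ?_⟩
  have hR : (-HA'ᵀ).IsHermitian := hHA'.transpose.neg
  have hK := jointHamiltonian_isHermitian hR hHA
  -- Sending an environment operator to the Choi matrix of the process it induces intertwines the
  -- two commutators. Hence dephasing `σ` time-averages the Choi matrix of `E`, which is already
  -- stationary.
  have h1 : ∀ Y, (choiMatrix ∘ₗ (dilationMap V).flip) (HB * Y - Y * HB) =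
      jointHamiltonian (-HA'ᵀ) HA * (choiMatrix ∘ₗ (dilationMap V).flip) Y -
        (choiMatrix ∘ₗ (dilationMap V).flip) Y * jointHamiltonian (-HA'ᵀ) HA := by
    intro Y
    refine choiMatrix_commutator HA HA' _ _ fun X => ?_
    rw [LinearMap.flip_apply, LinearMap.flip_apply, LinearMap.flip_apply, eq_sub_iff_add_eq',
      h.2.2.2.1.dilationMap_commutator hHA hHA' h.1 h.2.1]
  have h2 := map_timeAverage h.1 hK _ h1 σ
  have h3 : jointHamiltonian (-HA'ᵀ) HA * choiMatrix E =
      choiMatrix E * jointHamiltonian (-HA'ᵀ) HA := by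
    rw [← sub_eq_zero, ← choiMatrix_commutator HA HA' E 0 (fun X => by simp [hE X]), map_zero]
  rw [LinearMap.comp_apply, LinearMap.comp_apply, ← h.eq_dilationMap,
    timeAverage_of_commute hK h3] at h2
  exact (LinearMap.congr_fun (choiMatrix_injective h2) X).symm

/-- The linear map `X ↦ Tr_2 (N (1 ⊗ X))ᵀ` with Choi matrix `N`, as a bilinear function. -/
def ofChoiMatrix : Matrix (a' × a) (a' × a) ℂ →ₗ[ℂ] Matrix a a ℂ →ₗ[ℂ] Matrix a' a' ℂ :=
  LinearMap.mk₂ ℂ (fun N X => Matrix.of fun y x => ∑ i, ∑ j, N (x, i) (y, j) * X j i)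
    (fun N N' X => by ext; simp [add_mul, Finset.sum_add_distrib])
    (fun r N X => by ext; simp [Finset.mul_sum, mul_assoc])
    (fun N X X' => by ext; simp [mul_add, Finset.sum_add_distrib])
    (fun r N X => by ext; simp [Finset.mul_sum, mul_left_comm])

omit [DecidableEq a] [Fintype a'] [DecidableEq a'] in
theorem ofChoiMatrix_apply (N : Matrix (a' × a) (a' × a) ℂ) (X : Matrix a a ℂ) (y x : a') :
    ofChoiMatrix N X y x = ∑ i, ∑ j, N (x, i) (y, j) * X j i := rfl

/-- The partial trace over the first tensor factor. -/
def partialTraceLeft : Matrix (a' × a) (a' × a) ℂ →ₗ[ℂ] Matrix a a ℂ where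
  toFun N := Matrix.of fun i j => ∑ x, N (x, i) (x, j)
  map_add' N N' := by ext; simp [Finset.sum_add_distrib]
  map_smul' r N := by ext; simp [Finset.mul_sum]

omit [Fintype a] [DecidableEq a] [DecidableEq a'] in
theorem partialTraceLeft_apply (N : Matrix (a' × a) (a' × a) ℂ) (i j : a) :
    partialTraceLeft N i j = ∑ x, N (x, i) (x, j) := rfl

omit [DecidableEq a] [DecidableEq a'] in
-- Translates linear functionals of the output of the map into functionals of its Choi matrix;
-- together with `trace_one_kronecker_mul` it assembles the dual witness into one operator.
theorem trace_kronecker_mul (η : Matrix a' a' ℂ) (X : Matrix a a ℂ)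
    (N : Matrix (a' × a) (a' × a) ℂ) :
    ((η ⊗ₖ X) * N).trace = (ηᵀ * ofChoiMatrix N X).trace := by
  simp only [Matrix.trace, Matrix.diag_apply, Matrix.mul_apply, Fintype.sum_prod_type,
    kroneckerMap_apply, ofChoiMatrix_apply, transpose_apply, Finset.mul_sum]
  conv_rhs => rw [Finset.sum_comm]
  refine Finset.sum_congr rfl fun x _ => ?_
  rw [Finset.sum_comm]
  refine Finset.sum_congr rfl fun y _ => ?_
  rw [Finset.sum_comm]
  refine Finset.sum_congr rfl fun i _ => Finset.sum_congr rfl fun j _ => ?_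
  ring

omit [DecidableEq a] in
theorem trace_one_kronecker_mul (X : Matrix a a ℂ) (N : Matrix (a' × a) (a' × a) ℂ) :
    (((1 : Matrix a' a' ℂ) ⊗ₖ X) * N).trace = (X * partialTraceLeft N).trace := by
  simp only [Matrix.trace, Matrix.diag_apply, Matrix.mul_apply, Fintype.sum_prod_type,
    kroneckerMap_apply, partialTraceLeft_apply, Matrix.one_apply, Finset.mul_sum]
  rw [Finset.sum_comm]
  refine Finset.sum_congr rfl fun i _ => ?_
  conv_rhs => rw [Finset.sum_comm]
  refine Finset.sum_congr rfl fun x _ => ?_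
  rw [Finset.sum_comm]
  simp

/-- A factorisation `N = S† S` of the Choi matrix, with `S` intertwining the Hamiltonians, gives an
energy-conserving dilation with trivial input environment. -/
theorem isRealisation_of_factorisation {c : Type} [Fintype c] [DecidableEq c]
    {HC : Matrix c c ℂ} {N : Matrix (a' × a) (a' × a) ℂ}
    {S : Matrix c (a' × a) ℂ}
    (hHC : HC.IsHermitian) (hN : Sᴴ * S = N) (h1 : partialTraceLeft N = 1)
    (hS : S * jointHamiltonian (-HA'ᵀ) HA = HC * S) :
    IsRealisation (b := Fin 1) HA HA' (ofChoiMatrix N) 0 HC 1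
      (Matrix.of fun (p : a' × c) (r : a × Fin 1) => S p.2 (p.1, r.1)) := by
  have hN' : ∀ p q, N p q = ∑ k, star (S k p) * S k q := by
    intro p q
    rw [← hN]
    rfl
  refine ⟨isHermitian_zero, hHC, ⟨PosSemidef.one, by simp⟩, ⟨?_, ?_⟩, fun X => ?_⟩
  · ext ⟨i, k⟩ ⟨j, l⟩
    obtain rfl := Subsingleton.elim k l
    have := congrFun (congrFun h1 i) j
    rw [partialTraceLeft_apply] at this
    simp only [Matrix.mul_apply, Fintype.sum_prod_type, conjTranspose_apply, of_apply]
    simp only [hN'] at this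
    rw [this]
    simp [Matrix.one_apply]
  · ext ⟨y, k⟩ ⟨i, l⟩
    -- In the intertwining relation for `S`, the term with `-HA'ᵀ` moves to the other side and
    -- becomes `HA'` acting on the output index of the isometry.
    have := congrFun (congrFun hS k) (y, i)
    rw [mul_jointHamiltonian_apply, Matrix.mul_apply] at this
    rw [mul_jointHamiltonian_apply, jointHamiltonian_mul_apply]
    simp only [of_apply, Matrix.zero_apply, mul_zero, Finset.sum_const_zero, add_zero]
    rw [← this]
    simp [mul_comm]
  · ext y x
    rw [ofChoiMatrix_apply]
    simp only [partialTraceRight, of_apply, Matrix.mul_apply, Fintype.sum_prod_type,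
      Finset.univ_unique, Finset.sum_singleton, kroneckerMap_apply, Matrix.one_apply_eq, mul_one,
      conjTranspose_apply, Fin.default_eq_zero, hN', Finset.sum_mul]
    symm
    rw [Finset.sum_comm]
    refine Finset.sum_congr rfl fun i _ => ?_
    rw [Finset.sum_comm]
    refine Finset.sum_congr rfl fun j _ => Finset.sum_congr rfl fun k _ => ?_
    ring

end Covariance

section Ampliation

variable {r : Type*} {a : Type u} {a' : Type v} {b c : Type w}
  [Fintype r] [DecidableEq r]
  [Fintype a] [DecidableEq a] [Fintype a'] [DecidableEq a']
  [Fintype b] [DecidableEq b] [Fintype c] [DecidableEq c]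
  {HA : Matrix a a ℂ} {HA' : Matrix a' a' ℂ} {HB : Matrix b b ℂ} {HC : Matrix c c ℂ}

theorem IsRealisation.trace_apply {E : Matrix a a ℂ →ₗ[ℂ] Matrix a' a' ℂ} {σ : Matrix b b ℂ}
    {V : Matrix (a' × c) (a × b) ℂ} (h : IsRealisation HA HA' E HB HC σ V) (X : Matrix a a ℂ) :
    (E X).trace = X.trace := by
  have h1 : ∀ M : Matrix (a' × c) (a' × c) ℂ, (partialTraceRight M).trace = M.trace := by
    intro M
    simp [partialTraceRight, Matrix.trace, Fintype.sum_prod_type]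
  rw [h.2.2.2.2, h1, trace_mul_cycle, h.2.2.2.1.1, Matrix.one_mul, trace_kronecker,
    h.2.2.1.2, mul_one]

/-! ### Ampliation by a reference system -/

/-- The map `id ⊗ E`. -/
def ampliation (r : Type*) (E : Matrix a a ℂ →ₗ[ℂ] Matrix a' a' ℂ) :
    Matrix (r × a) (r × a) ℂ →ₗ[ℂ] Matrix (r × a') (r × a') ℂ where
  toFun M := Matrix.of fun p q => E (M.submatrix (Prod.mk p.1) (Prod.mk q.1)) p.2 q.2
  map_add' M M' := by
    ext p q
    simp [Matrix.submatrix_add]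
  map_smul' s M := by
    ext p q
    simp [Matrix.submatrix_smul]

omit [Fintype r] [DecidableEq r] [Fintype a] [DecidableEq a] [Fintype a'] [DecidableEq a'] in
theorem ampliation_apply (E : Matrix a a ℂ →ₗ[ℂ] Matrix a' a' ℂ) (M : Matrix (r × a) (r × a) ℂ)
    (i j : r) (x y : a') :
    ampliation r E M (i, x) (j, y) = E (M.submatrix (Prod.mk i) (Prod.mk j)) x y := rfl

omit [Fintype r] [DecidableEq r] [Fintype a] [DecidableEq a] [Fintype a'] [DecidableEq a'] in
theorem ampliation_kronecker (E : Matrix a a ℂ →ₗ[ℂ] Matrix a' a' ℂ) (η : Matrix r r ℂ)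
    (X : Matrix a a ℂ) : ampliation r E (η ⊗ₖ X) = η ⊗ₖ E X := by
  ext ⟨i, x⟩ ⟨j, y⟩
  have : (η ⊗ₖ X).submatrix (Prod.mk i) (Prod.mk j) = η i j • X := by
    ext; simp
  rw [ampliation_apply, this]
  simp

theorem IsCovariant.ampliation_commutator {E : Matrix a a ℂ →ₗ[ℂ] Matrix a' a' ℂ}
    (hE : IsCovariant HA HA' E) (HR : Matrix r r ℂ) (M : Matrix (r × a) (r × a) ℂ) :
    ampliation r E (jointHamiltonian HR HA * M - M * jointHamiltonian HR HA) =
      jointHamiltonian HR HA' * ampliation r E M - ampliation r E M * jointHamiltonian HR HA' := by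
  ext ⟨i, x⟩ ⟨j, y⟩
  have h1 : (jointHamiltonian HR HA * M - M * jointHamiltonian HR HA).submatrix
      (Prod.mk i) (Prod.mk j) =
      (∑ k, HR i k • M.submatrix (Prod.mk k) (Prod.mk j) -
        ∑ k, HR k j • M.submatrix (Prod.mk i) (Prod.mk k)) +
      (HA * M.submatrix (Prod.mk i) (Prod.mk j) - M.submatrix (Prod.mk i) (Prod.mk j) * HA) := by
    ext p q
    rw [Matrix.submatrix_apply, Matrix.sub_apply, jointHamiltonian_mul_apply,
      mul_jointHamiltonian_apply]
    simp only [Matrix.submatrix_apply, Matrix.sub_apply, Matrix.add_apply, Matrix.sum_apply,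
      Matrix.smul_apply, smul_eq_mul, Matrix.mul_apply, mul_comm (M _ _) (HR _ _)]
    ring
  rw [ampliation_apply, h1, map_add, hE, Matrix.sub_apply, jointHamiltonian_mul_apply,
    mul_jointHamiltonian_apply]
  simp only [ampliation_apply, map_sub, map_sum, map_smul, Matrix.add_apply, Matrix.sub_apply,
    Matrix.sum_apply, Matrix.smul_apply, smul_eq_mul, Matrix.mul_apply]
  simp only [mul_comm _ (HR _ j)]
  ring

omit [DecidableEq a] [Fintype a'] [DecidableEq a'] in
theorem one_kronecker_conj_apply (W : Matrix a' a ℂ) (M : Matrix (r × a) (r × a) ℂ)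
    (i j : r) (x y : a') :
    (((1 : Matrix r r ℂ) ⊗ₖ W) * M * ((1 : Matrix r r ℂ) ⊗ₖ W)ᴴ) (i, x) (j, y) =
      (W * M.submatrix (Prod.mk i) (Prod.mk j) * Wᴴ) x y := by
  rw [conjTranspose_kronecker, conjTranspose_one]
  simp [Matrix.mul_apply, Fintype.sum_prod_type, Matrix.one_apply]

theorem IsRealisation.ampliation_posSemidef {E : Matrix a a ℂ →ₗ[ℂ] Matrix a' a' ℂ}
    {σ : Matrix b b ℂ} {V : Matrix (a' × c) (a × b) ℂ} (h : IsRealisation HA HA' E HB HC σ V)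
    {M : Matrix (r × a) (r × a) ℂ} (hM : M.PosSemidef) : (ampliation r E M).PosSemidef := by
  have h1 : ((M ⊗ₖ σ).submatrix (Equiv.prodAssoc r a b).symm
      (Equiv.prodAssoc r a b).symm).PosSemidef := (hM.kronecker h.2.2.1.1).submatrix _
  -- Kraus-type decomposition: one block of `V` for each basis vector of the discarded system `C`.
  have h2 : ampliation r E M = ∑ k, ((1 : Matrix r r ℂ) ⊗ₖ V.submatrix (fun x => (x, k)) id) *
      (M ⊗ₖ σ).submatrix (Equiv.prodAssoc r a b).symm (Equiv.prodAssoc r a b).symm *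
      ((1 : Matrix r r ℂ) ⊗ₖ V.submatrix (fun x => (x, k)) id)ᴴ := by
    ext ⟨i, x⟩ ⟨j, y⟩
    rw [ampliation_apply, h.2.2.2.2, Matrix.sum_apply, partialTraceRight, of_apply]
    refine Finset.sum_congr rfl fun k _ => ?_
    rw [one_kronecker_conj_apply]
    rfl
  rw [h2]
  exact posSemidef_sum _ fun k _ => h1.mul_mul_conjTranspose_same _

theorem IsRealisation.posSemidef {E : Matrix a a ℂ →ₗ[ℂ] Matrix a' a' ℂ}
    {σ : Matrix b b ℂ} {V : Matrix (a' × c) (a × b) ℂ} (h : IsRealisation HA HA' E HB HC σ V)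
    {X : Matrix a a ℂ} (hX : X.PosSemidef) : (E X).PosSemidef := by
  have h1 := h.ampliation_posSemidef (r := Fin 1) (M := 1 ⊗ₖ X) (PosSemidef.one.kronecker hX)
  rw [ampliation_kronecker] at h1
  convert h1.submatrix (fun x => ((0 : Fin 1), x)) using 1
  ext
  simp

end Ampliation

/-! ### The conditional min-entropy -/

section MinEntropy

variable {r : Type u} {a : Type v} [Fintype r] [DecidableEq r] [Fintype a]

/-- The set of traces over which the conditional min-entropy takes the infimum. -/
def feasibleTraces (Ω : Matrix (r × a) (r × a) ℂ) : Set ℝ :=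
  {x : ℝ | ∃ τ : Matrix a a ℂ, τ.PosSemidef ∧
    ((1 : Matrix r r ℂ) ⊗ₖ τ - Ω).PosSemidef ∧ x = τ.trace.re}

theorem posSemidef_one_sub {n : Type*} [Fintype n] [DecidableEq n] {Ω : Matrix n n ℂ}
    (hΩ : IsState Ω) : (1 - Ω).PosSemidef := by
  have hH := hΩ.1.isHermitian
  have hU : (hH.eigenvectorUnitary : Matrix n n ℂ) * (hH.eigenvectorUnitary : Matrix n n ℂ)ᴴ = 1 :=
    Unitary.mul_star_self_of_mem hH.eigenvectorUnitary.2
  have h1 : ∑ i, hH.eigenvalues i = 1 := by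
    have := hH.trace_eq_sum_eigenvalues
    rw [hΩ.2] at this
    have h : ((∑ i, hH.eigenvalues i : ℝ) : ℂ) = 1 := by
      rw [Complex.ofReal_sum]
      exact this.symm
    exact_mod_cast h
  have h2 : 1 - Ω = (hH.eigenvectorUnitary : Matrix n n ℂ) *
      diagonal (fun i => 1 - (hH.eigenvalues i : ℂ)) *
      (hH.eigenvectorUnitary : Matrix n n ℂ)ᴴ := by
    conv_lhs => rw [eigenvectorUnitary_conj hH, ← hU]
    rw [← diagonal_sub, diagonal_one, Matrix.mul_sub, Matrix.sub_mul, Matrix.mul_one]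
  rw [h2]
  refine PosSemidef.mul_mul_conjTranspose_same (PosSemidef.diagonal fun i => ?_) _
  have h3 : hH.eigenvalues i ≤ 1 := h1 ▸ Finset.single_le_sum
    (fun j _ => hΩ.1.eigenvalues_nonneg j) (Finset.mem_univ i)
  simpa using (by exact_mod_cast h3 : (hH.eigenvalues i : ℂ) ≤ 1)

theorem feasibleTraces_nonempty [DecidableEq a] {Ω : Matrix (r × a) (r × a) ℂ}
    (hΩ : IsState Ω) : (feasibleTraces Ω).Nonempty :=
  ⟨_, 1, PosSemidef.one, by rw [one_kronecker_one]; exact posSemidef_one_sub hΩ, rfl⟩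

theorem inv_card_le_of_mem_feasibleTraces [Nonempty r] {Ω : Matrix (r × a) (r × a) ℂ}
    (hΩ : IsState Ω) {x : ℝ} (hx : x ∈ feasibleTraces Ω) : (Fintype.card r : ℝ)⁻¹ ≤ x := by
  obtain ⟨τ, -, h1, rfl⟩ := hx
  have h2 := (Complex.le_def.1 h1.trace_nonneg).1
  rw [trace_sub, trace_kronecker, trace_one, hΩ.2] at h2
  rw [inv_le_iff_one_le_mul₀ (by exact_mod_cast Fintype.card_pos)]
  simp at h2
  linarith

/-- The logarithm is strictly monotone only on positive numbers. Taking traces in `1 ⊗ τ ≥ Ω` keeps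
both infima at or above the inverse dimension of the reference. -/
theorem condMinEntropy_le_iff [DecidableEq a] [Nonempty r] {b : Type w} [Fintype b]
    [DecidableEq b] {Ω : Matrix (r × a) (r × a) ℂ} {Ω' : Matrix (r × b) (r × b) ℂ}
    (hΩ : IsState Ω) (hΩ' : IsState Ω') :
    condMinEntropy Ω ≤ condMinEntropy Ω' ↔ sInf (feasibleTraces Ω') ≤ sInf (feasibleTraces Ω) := by
  have hc : 0 < (Fintype.card r : ℝ)⁻¹ := inv_pos.2 (by exact_mod_cast Fintype.card_pos)
  have h1 : 0 < sInf (feasibleTraces Ω) := hc.trans_le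
    (le_csInf (feasibleTraces_nonempty hΩ) fun _ => inv_card_le_of_mem_feasibleTraces hΩ)
  have h2 : 0 < sInf (feasibleTraces Ω') := hc.trans_le
    (le_csInf (feasibleTraces_nonempty hΩ') fun _ => inv_card_le_of_mem_feasibleTraces hΩ')
  rw [← Real.logb_le_logb (b := 2) (by norm_num) h2 h1]
  exact neg_le_neg_iff

omit [Fintype r] in
theorem feasibleTraces_bddBelow {Ω : Matrix (r × a) (r × a) ℂ} : BddBelow (feasibleTraces Ω) := by
  refine ⟨0, ?_⟩
  rintro x ⟨τ, h, -, rfl⟩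
  exact (Complex.le_def.1 h.trace_nonneg).1

end MinEntropy

/-! ### Monotonicity of the reference entropies -/

section Reference

variable {r : Type w} {a : Type u} {a' : Type v}
  [Fintype r] [DecidableEq r] [Fintype a] [DecidableEq a] [Fintype a'] [DecidableEq a']

/-- The classical-quantum mixture `q η₁ ⊗ ρ + (1 - q) η₂ ⊗ γ`. -/
def referenceMixture (q : ℝ) (η₁ η₂ : Matrix r r ℂ) (ρ γ : Matrix a a ℂ) :
    Matrix (r × a) (r × a) ℂ :=
  (q : ℂ) • (η₁ ⊗ₖ ρ) + (1 - (q : ℂ)) • (η₂ ⊗ₖ γ)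

omit [DecidableEq r] [DecidableEq a] in
theorem referenceMixture_isState {q : ℝ} (hq0 : 0 < q) (hq1 : q < 1) {η₁ η₂ : Matrix r r ℂ}
    {ρ γ : Matrix a a ℂ} (h1 : IsState η₁) (h2 : IsState η₂) (hρ : IsState ρ) (hγ : IsState γ) :
    IsState (referenceMixture q η₁ η₂ ρ γ) := by
  constructor
  · refine ((h1.1.kronecker hρ.1).smul ?_).add ((h2.1.kronecker hγ.1).smul ?_)
    · exact_mod_cast hq0.le
    · rw [sub_nonneg]
      exact_mod_cast hq1.le
  · rw [referenceMixture, trace_add, trace_smul, trace_smul, trace_kronecker, trace_kronecker,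
      h1.2, h2.2, hρ.2, hγ.2]
    simp

theorem nonempty_of_isState {n : Type*} [Fintype n] {ρ : Matrix n n ℂ} (h : IsState ρ) :
    Nonempty n := by
  by_contra hn
  rw [not_nonempty_iff] at hn
  have := h.2
  simp [Matrix.trace] at this

/-- Thermal processes do not decrease the reference entropies. -/
theorem IsThermalProcess.referenceEntropy_le {HA : Matrix a a ℂ} {HA' : Matrix a' a' ℂ}
    {HR : Matrix r r ℂ} {β q : ℝ} {E : Matrix a a ℂ →ₗ[ℂ] Matrix a' a' ℂ}
    (hE : IsThermalProcess β HA HA' E) (hHA : HA.IsHermitian) (hHA' : HA'.IsHermitian)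
    (hHR : HR.IsHermitian) (hq0 : 0 < q) (hq1 : q < 1) {η₁ η₂ : Matrix r r ℂ} {ρ : Matrix a a ℂ}
    (h1 : IsState η₁) (h2 : IsState η₂) (hρ : IsState ρ) :
    referenceEntropy β q HR HA η₁ η₂ ρ ≤ referenceEntropy β q HR HA' η₁ η₂ (E ρ) := by
  obtain ⟨m, k, HB, HC, σ, V, hV⟩ := hE.conservation
  obtain ⟨W, hW⟩ := hE.incoherence m k HB HC σ V hV
  -- The only use of incoherence: the dephased environment is stationary, so `E` is covariant.
  have hcov := hW.isCovariant hHA hHA' (timeAverage_commute hV.1 σ)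
  have hEρ : IsState (E ρ) := ⟨hV.posSemidef hρ.1, (hV.trace_apply ρ).trans hρ.2⟩
  have hr := nonempty_of_isState h1
  have ha := nonempty_of_isState hρ
  have ha' := nonempty_of_isState hEρ
  have hK := jointHamiltonian_isHermitian hHR hHA
  have hK' := jointHamiltonian_isHermitian hHR hHA'
  have hΩ := timeAverage_isState hK
    (referenceMixture_isState hq0 hq1 h1 h2 hρ (gibbsState_isState β hHA))
  have hΩ' := timeAverage_isState hK'
    (referenceMixture_isState hq0 hq1 h1 h2 hEρ (gibbsState_isState β hHA'))
  have hmap : ampliation r E (timeAverage (jointHamiltonian HR HA)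
      (referenceMixture q η₁ η₂ ρ (gibbsState β HA))) = timeAverage (jointHamiltonian HR HA')
      (referenceMixture q η₁ η₂ (E ρ) (gibbsState β HA')) := by
    rw [map_timeAverage hK hK' _ (hcov.ampliation_commutator HR), referenceMixture, map_add,
      map_smul, map_smul, ampliation_kronecker, ampliation_kronecker, hE.equilibrium]
    rfl
  refine (condMinEntropy_le_iff hΩ hΩ').2 (le_csInf (feasibleTraces_nonempty hΩ) ?_)
  rintro x ⟨τ, hτ, hle, rfl⟩
  -- Applying `id ⊗ E` to `1 ⊗ τ - Ω ≥ 0` gives the operator inequality for `E τ`.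
  refine csInf_le feasibleTraces_bddBelow ⟨E τ, hV.posSemidef hτ, ?_, by rw [hV.trace_apply]⟩
  have := hV.ampliation_posSemidef hle
  rwa [map_sub, ampliation_kronecker, hmap] at this

end Reference

/-! ### Positive semidefinite matrices -/

section PosSemidef

variable {n : Type u} [Fintype n]

open scoped MatrixOrder in
-- The square root is a function of `N`, so it commutes with whatever commutes with `N`.
theorem exists_factor_of_posSemidef_of_commute [DecidableEq n] {N K : Matrix n n ℂ}
    (hN : N.PosSemidef) (hK : K * N = N * K) : ∃ S : Matrix n n ℂ, Sᴴ * S = N ∧ S * K = K * S := by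
  have h1 : (CFC.sqrt N).PosSemidef := nonneg_iff_posSemidef.1 (CFC.sqrt_nonneg N)
  refine ⟨CFC.sqrt N, ?_, ?_⟩
  · rw [h1.isHermitian.eq]
    exact CFC.sqrt_mul_sqrt_self N (nonneg_iff_posSemidef.2 hN)
  · have h2 : Commute N K := hK.symm
    exact h2.cfcₙ_nnreal _

theorem trace_vecMulVec_star_mul (M : Matrix n n ℂ) (x : n → ℂ) :
    (vecMulVec x (star x) * M).trace = star x ⬝ᵥ M *ᵥ x := by
  rw [vecMulVec_mul, trace_vecMulVec, dotProduct_comm, dotProduct_mulVec]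

theorem posSemidef_of_trace_mul_nonneg {M : Matrix n n ℂ} (hM : M.IsHermitian)
    (h : ∀ N : Matrix n n ℂ, N.PosSemidef → 0 ≤ (N * M).trace.re) : M.PosSemidef := by
  refine PosSemidef.of_dotProduct_mulVec_nonneg hM fun x => ?_
  rw [Complex.le_def]
  refine ⟨?_, (hM.im_star_dotProduct_mulVec_self x).symm⟩
  rw [← trace_vecMulVec_star_mul]
  exact h _ (posSemidef_vecMulVec_self_star x)

theorem re_trace_mul_conjTranspose {N : Matrix n n ℂ} (hN : N.IsHermitian) (D : Matrix n n ℂ) :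
    (Dᴴ * N).trace.re = (D * N).trace.re := by
  have : Dᴴ * N = (N * D)ᴴ := by rw [conjTranspose_mul, hN.eq]
  rw [this, trace_conjTranspose, trace_mul_comm]
  simp

theorem isHermitian_timeAverage [DecidableEq n] {H ω : Matrix n n ℂ} (hH : H.IsHermitian)
    (hω : ω.IsHermitian) : (timeAverage H ω).IsHermitian := by
  obtain ⟨Y, hY⟩ := exists_sub_timeAverage hH ω
  refine Eq.symm (timeAverage_unique hH (Y := -Yᴴ) ?_ ?_)
  · have := congrArg conjTranspose (timeAverage_commute hH ω)
    rw [conjTranspose_mul, conjTranspose_mul, hH.eq] at this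
    exact this.symm
  · have := congrArg conjTranspose hY
    rw [conjTranspose_sub, conjTranspose_sub, conjTranspose_mul, conjTranspose_mul, hH.eq,
      hω.eq] at this
    rw [this]
    noncomm_ring

/-- The set is the image under `S ↦ S† S` of a Hilbert-Schmidt sphere, because the trace of `S† S`
is the sum of the squared moduli of the entries of `S`. -/
theorem isCompact_posSemidef_trace [DecidableEq n] (d : ℝ) :
    IsCompact {N : Matrix n n ℂ | N.PosSemidef ∧ N.trace = d} := by
  have htr : ∀ S : Matrix n n ℂ, (Sᴴ * S).trace = ((∑ i, ∑ j, ‖S j i‖ ^ 2 : ℝ) : ℂ) := by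
    intro S
    simp only [Matrix.trace, Matrix.diag_apply, Matrix.mul_apply, conjTranspose_apply]
    push_cast
    refine Finset.sum_congr rfl fun i _ => Finset.sum_congr rfl fun j _ => ?_
    exact Complex.conj_mul' _
  have hK : IsCompact {S : Matrix n n ℂ | (Sᴴ * S).trace = d} := by
    have hc : IsCompact (Set.univ.pi fun _ : n => Set.univ.pi fun _ : n =>
        Metric.closedBall (0 : ℂ) (Real.sqrt d)) :=
      isCompact_univ_pi fun _ => isCompact_univ_pi fun _ => isCompact_closedBall _ _
    refine hc.of_isClosed_subset (isClosed_eq (by fun_prop) (by fun_prop)) ?_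
    intro (S : Matrix n n ℂ) (hS : (Sᴴ * S).trace = d) i _ j _
    rw [htr] at hS
    have hS' : ∑ i, ∑ j, ‖S j i‖ ^ 2 = d := by exact_mod_cast hS
    rw [mem_closedBall_zero_iff]
    refine Real.le_sqrt_of_sq_le (hS' ▸ ?_)
    exact (Finset.single_le_sum (f := fun k => ‖S k j‖ ^ 2) (fun _ _ => by positivity)
      (Finset.mem_univ i)).trans (Finset.single_le_sum (f := fun l => ∑ k, ‖S k l‖ ^ 2)
      (fun _ _ => by positivity) (Finset.mem_univ j))
  have himg : {N : Matrix n n ℂ | N.PosSemidef ∧ N.trace = d} =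
      (fun S : Matrix n n ℂ => Sᴴ * S) '' {S | (Sᴴ * S).trace = d} := by
    ext N
    constructor
    · rintro ⟨h1, h2⟩
      obtain ⟨S, hS, -⟩ := exists_factor_of_posSemidef_of_commute (K := 0) h1 (by simp)
      exact ⟨S, by rw [Set.mem_ofPred_eq, hS, h2], hS⟩
    · rintro ⟨S, hS, rfl⟩
      exact ⟨posSemidef_conjTranspose_mul_self S, hS⟩
  rw [himg]
  exact hK.image (by fun_prop)

/-- Up to a scalar multiple and a multiple of the identity, Hermitian matrices are states. -/
theorem eventually_exists_isState [DecidableEq n] [Nonempty n] {X : Matrix n n ℂ}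
    (hX : X.IsHermitian) {p : ℝ} (hp : 0 < p) :
    ∀ᶠ t : ℝ in atTop, ∃ (η : Matrix n n ℂ) (s : ℝ), IsState η ∧
      ((p * t : ℝ) : ℂ) • η = X + (s : ℂ) • 1 := by
  have hd : 0 < (Fintype.card n : ℝ) := by exact_mod_cast Fintype.card_pos
  obtain ⟨C, hC⟩ : ∃ C : ℝ, ∀ s : ℝ, C ≤ s → (X + (s : ℂ) • 1).PosSemidef := by
    refine ⟨∑ i, |hX.eigenvalues i|, fun s hs => ?_⟩
    have hU : (hX.eigenvectorUnitary : Matrix n n ℂ) *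
        (hX.eigenvectorUnitary : Matrix n n ℂ)ᴴ = 1 :=
      Unitary.mul_star_self_of_mem hX.eigenvectorUnitary.2
    have h2 : X + (s : ℂ) • 1 = (hX.eigenvectorUnitary : Matrix n n ℂ) *
        diagonal (fun i => (hX.eigenvalues i : ℂ) + s) *
        (hX.eigenvectorUnitary : Matrix n n ℂ)ᴴ := by
      conv_lhs => rw [eigenvectorUnitary_conj hX, ← hU]
      rw [← diagonal_add, ← smul_one_eq_diagonal, Matrix.mul_add, Matrix.add_mul,
        Matrix.mul_smul, Matrix.smul_mul, Matrix.mul_one]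
    rw [h2]
    refine PosSemidef.mul_mul_conjTranspose_same (PosSemidef.diagonal fun i => ?_) _
    have h3 : |hX.eigenvalues i| ≤ ∑ i, |hX.eigenvalues i| := Finset.single_le_sum
      (f := fun i => |hX.eigenvalues i|) (fun j _ => abs_nonneg _) (Finset.mem_univ i)
    have h4 : 0 ≤ hX.eigenvalues i + s := by linarith [neg_abs_le (hX.eigenvalues i)]
    simpa using (by exact_mod_cast h4 : (0 : ℂ) ≤ (hX.eigenvalues i : ℂ) + s)
  have htr : ((X.trace.re : ℝ) : ℂ) = X.trace := by
    refine Complex.conj_eq_iff_re.1 ?_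
    rw [starRingEnd_apply, ← trace_conjTranspose, hX.eq]
  filter_upwards [eventually_ge_atTop ((C * Fintype.card n + X.trace.re) / p),
    eventually_gt_atTop 0] with t ht1 ht0
  have hpt : ((p * t : ℝ) : ℂ) ≠ 0 := by exact_mod_cast (mul_pos hp ht0).ne'
  -- The shift is forced by normalisation: `X + s` must have trace `p * t`. It grows with `t`, hence
  -- eventually exceeds the threshold `C` for positivity.
  set s : ℝ := (p * t - X.trace.re) / Fintype.card n with hs
  have hCs : C ≤ s := by
    rw [div_le_iff₀ hp] at ht1
    rw [hs, le_div_iff₀ hd]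
    linarith
  refine ⟨((p * t : ℝ) : ℂ)⁻¹ • (X + (s : ℂ) • 1), s, ⟨(hC s hCs).smul ?_, ?_⟩, ?_⟩
  · rw [← Complex.ofReal_inv]
    exact_mod_cast (inv_pos.2 (mul_pos hp ht0)).le
  · rw [trace_smul, trace_add, trace_smul, trace_one, smul_eq_mul, inv_mul_eq_one₀ hpt, ← htr,
      smul_eq_mul]
    norm_cast
    rw [hs]
    field_simp
    ring
  · rw [smul_smul, mul_inv_cancel₀ hpt, one_smul]

theorem exists_trace_mul_eq [DecidableEq n] (g : Matrix n n ℂ →ₗ[ℂ] ℂ) :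
    ∃ Y : Matrix n n ℂ, ∀ M, g M = (Y * M).trace := by
  refine ⟨Matrix.of fun j i => g (Matrix.single i j 1), fun M => ?_⟩
  conv_lhs => rw [matrix_eq_sum_single M]
  simp only [map_sum, Matrix.trace, Matrix.diag_apply, Matrix.mul_apply, of_apply]
  rw [Finset.sum_comm]
  refine Finset.sum_congr rfl fun i _ => Finset.sum_congr rfl fun j _ => ?_
  rw [mul_comm, ← smul_eq_mul, ← map_smul, smul_single, smul_eq_mul, mul_one]

end PosSemidef

/-! ### Thermal processes from Choi matrices -/

section Choi

variable {a : Type u} {a' : Type v} [Fintype a] [DecidableEq a] [Fintype a'] [DecidableEq a']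
  {HA : Matrix a a ℂ} {HA' : Matrix a' a' ℂ}

/-- The square root of `N` supplies a dilation with trivial input environment; the output
environment carries the joint Hamiltonian itself, reindexed by `Fin`. A trivial environment is
stationary, so the map is covariant, and incoherence then holds in every dilation with `W = V`. -/
theorem isThermalProcess_ofChoiMatrix {β : ℝ} (hHA : HA.IsHermitian) (hHA' : HA'.IsHermitian)
    {N : Matrix (a' × a) (a' × a) ℂ} (hN : N.PosSemidef)
    (hK : jointHamiltonian (-HA'ᵀ) HA * N = N * jointHamiltonian (-HA'ᵀ) HA)
    (h1 : partialTraceLeft N = 1) (h2 : ofChoiMatrix N (gibbsState β HA) = gibbsState β HA') :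
    IsThermalProcess β HA HA' (ofChoiMatrix N) := by
  obtain ⟨S, hS, hSK⟩ := exists_factor_of_posSemidef_of_commute hN hK
  have hKH := jointHamiltonian_isHermitian (hHA'.transpose.neg) hHA
  set f := (Fintype.equivFin (a' × a)).symm
  have hr := isRealisation_of_factorisation (HA := HA) (HA' := HA') (N := N)
    (S := S.submatrix f id) (hKH.submatrix f)
    (by
      rw [conjTranspose_submatrix, submatrix_mul_equiv, hS, submatrix_id_id]) h1
    (by
      rw [submatrix_mul_equiv, ← hSK]
      conv_rhs => rw [← submatrix_mul_equiv S _ f (Equiv.refl _) id]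
      rfl)
  have hcov := hr.isCovariant hHA hHA' (by simp)
  exact ⟨⟨_, _, _, _, _, _, hr⟩, h2, fun m k HB HC σ V hV => ⟨V, hV.timeAverage hHA hHA' hcov⟩⟩

end Choi

/-! ### Separation -/

section Separation

variable {a : Type u} {a' : Type v} [Fintype a] [DecidableEq a] [Fintype a'] [DecidableEq a']

/-- If no covariant channel maps `ρ` to `σ` and `γ` to `γ'`, there is a dual witness. -/
theorem exists_dual_witness [Nonempty a] {K : Matrix (a' × a) (a' × a) ℂ}
    {ρ γ : Matrix a a ℂ} {σ γ' : Matrix a' a' ℂ} (hρ : ρ.IsHermitian) (hγ : γ.IsHermitian)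
    (hσ : σ.IsHermitian) (hγ' : γ'.IsHermitian)
    (h : ¬ ∃ N : Matrix (a' × a) (a' × a) ℂ, N.PosSemidef ∧ K * N = N * K ∧
      partialTraceLeft N = 1 ∧ ofChoiMatrix N ρ = σ ∧ ofChoiMatrix N γ = γ') :
    ∃ (Z : Matrix a a ℂ) (X₁ X₂ : Matrix a' a' ℂ),
      Z.IsHermitian ∧ X₁.IsHermitian ∧ X₂.IsHermitian ∧
      (∀ N : Matrix (a' × a) (a' × a) ℂ, N.PosSemidef → K * N = N * K →
        (((1 : Matrix a' a' ℂ) ⊗ₖ Z + X₁ᵀ ⊗ₖ ρ + X₂ᵀ ⊗ₖ γ) * N).trace.re ≤ 0) ∧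
      0 < (Z.trace + (X₁ * σ).trace + (X₂ * γ').trace).re := by
  have hd : 0 < (Fintype.card a : ℝ) := by exact_mod_cast Fintype.card_pos
  set d : ℝ := (Fintype.card a : ℝ) with hd_def
  -- The condition `Tr_{A'} N = 1` fixes the trace to be `dim A`. Cutting the cone at that trace
  -- makes it compact, so its linear image is closed and can be separated strictly from the target
  -- point.
  set J : Set (Matrix (a' × a) (a' × a) ℂ) :=
    {N | N.PosSemidef ∧ N.trace = d} ∩ {N | K * N = N * K} with hJ
  have hJc : IsCompact J :=
    (isCompact_posSemidef_trace d).inter_right (isClosed_eq (by fun_prop) (by fun_prop))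
  have hJx : Convex ℝ J := by
    rintro M ⟨⟨hM1, hM2⟩, hM3⟩ N ⟨⟨hN1, hN2⟩, hN3⟩ s t hs ht hst
    rw [Set.mem_ofPred_eq] at hM3 hN3
    refine ⟨⟨(hM1.smul hs).add (hN1.smul ht), ?_⟩, ?_⟩
    · rw [trace_add, trace_smul, trace_smul, hM2, hN2, ← add_smul, hst, one_smul]
    · rw [Set.mem_ofPred_eq, mul_add, add_mul, Matrix.mul_smul, Matrix.mul_smul, Matrix.smul_mul,
        Matrix.smul_mul, hM3, hN3]
  let L : Matrix (a' × a) (a' × a) ℂ →ₗ[ℂ] Matrix a a ℂ × Matrix a' a' ℂ × Matrix a' a' ℂ :=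
    partialTraceLeft.prod ((ofChoiMatrix.flip ρ).prod (ofChoiMatrix.flip γ))
  have hLc : Continuous L := L.continuous_of_finiteDimensional
  have hLx : Convex ℝ (L '' J) := hJx.linear_image (L.restrictScalars ℝ)
  have hnot : ((1, σ, γ') : Matrix a a ℂ × Matrix a' a' ℂ × Matrix a' a' ℂ) ∉ L '' J := by
    rintro ⟨N, ⟨⟨hN1, -⟩, hN3⟩, hN⟩
    exact h ⟨N, hN1, hN3, congrArg Prod.fst hN, congrArg (fun p => p.2.1) hN,
      congrArg (fun p => p.2.2) hN⟩
  have : LocallyConvexSpace ℝ (Matrix a a ℂ) :=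
    inferInstanceAs (LocallyConvexSpace ℝ (a → a → ℂ))
  have : LocallyConvexSpace ℝ (Matrix a' a' ℂ) :=
    inferInstanceAs (LocallyConvexSpace ℝ (a' → a' → ℂ))
  obtain ⟨f, u, hf1, hf2⟩ := RCLike.geometric_hahn_banach_closed_point (𝕜 := ℂ) hLx
    (hJc.image hLc).isClosed hnot
  obtain ⟨Y, hY⟩ := exists_trace_mul_eq (f.toLinearMap ∘ₗ LinearMap.inl ℂ _ _)
  obtain ⟨Y₁, hY₁⟩ := exists_trace_mul_eq
    (f.toLinearMap ∘ₗ LinearMap.inr ℂ _ _ ∘ₗ LinearMap.inl ℂ _ _)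
  obtain ⟨Y₂, hY₂⟩ := exists_trace_mul_eq
    (f.toLinearMap ∘ₗ LinearMap.inr ℂ _ _ ∘ₗ LinearMap.inr ℂ _ _)
  have hf : ∀ M M₁ M₂, f (M, M₁, M₂) = (Y * M).trace + (Y₁ * M₁).trace + (Y₂ * M₂).trace := by
    intro M M₁ M₂
    rw [← hY, ← hY₁, ← hY₂]
    simp only [LinearMap.comp_apply, LinearMap.inl_apply, LinearMap.inr_apply,
      ContinuousLinearMap.coe_coe]
    rw [← map_add, ← map_add]
    simp
  -- Since every `N` in `J` has trace `d`, subtracting `u / d` from `Y` moves the separating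
  -- threshold from `u` to `0`. By homogeneity the inequality then extends to the whole cone.
  set Z₀ : Matrix a a ℂ := Y - ((u / d : ℝ) : ℂ) • 1 with hZ₀
  set D : Matrix (a' × a) (a' × a) ℂ :=
    (1 : Matrix a' a' ℂ) ⊗ₖ Z₀ + Y₁ᵀ ⊗ₖ ρ + Y₂ᵀ ⊗ₖ γ with hD
  have hfL : ∀ N, (D * N).trace = f (L N) - (u / d : ℝ) * N.trace := by
    intro N
    have h1 : L N = (partialTraceLeft N, ofChoiMatrix N ρ, ofChoiMatrix N γ) := rfl
    have h2 : (partialTraceLeft N).trace = N.trace := by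
      rw [← Matrix.one_mul (partialTraceLeft N), ← trace_one_kronecker_mul, one_kronecker_one,
        Matrix.one_mul]
    rw [h1, hf, hD, add_mul, add_mul, trace_add, trace_add, trace_one_kronecker_mul,
      trace_kronecker_mul, trace_kronecker_mul, transpose_transpose, transpose_transpose, hZ₀,
      sub_mul, trace_sub, Matrix.smul_mul, Matrix.one_mul, trace_smul, h2, smul_eq_mul]
    ring
  have hneg : ∀ N : Matrix (a' × a) (a' × a) ℂ, N.PosSemidef → K * N = N * K →
      (D * N).trace.re ≤ 0 := by
    intro N hN hKN
    have ht := Complex.le_def.1 hN.trace_nonneg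
    have ht2 : N.trace = (N.trace.re : ℂ) := Complex.ext rfl (by simpa using ht.2.symm)
    set t : ℝ := N.trace.re with ht_def
    rcases (show (0 : ℝ) ≤ t from ht.1).eq_or_lt with h0 | h0
    · have : N = 0 := hN.trace_eq_zero_iff.1 (by rw [ht2, ← h0, Complex.ofReal_zero])
      simp [this]
    · have h3 : ((d / t : ℝ) • N) ∈ J := by
        refine ⟨⟨hN.smul (div_pos hd h0).le, ?_⟩, ?_⟩
        · rw [trace_smul, ht2, Complex.real_smul, ← Complex.ofReal_mul, div_mul_cancel₀ _ h0.ne']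
        · rw [Set.mem_ofPred_eq, Matrix.mul_smul, Matrix.smul_mul, hKN]
      have h4 := hf1 _ ⟨_, h3, rfl⟩
      have h5 : L ((d / t : ℝ) • N) = ((d / t : ℝ) : ℂ) • L N := by
        rw [← map_smul]
        congr 1
      rw [h5, map_smul, smul_eq_mul, RCLike.re_eq_complex_re, Complex.re_ofReal_mul] at h4
      rw [hfL, ht2, ← Complex.ofReal_mul, Complex.sub_re, Complex.ofReal_re]
      rw [div_mul_eq_mul_div, div_lt_iff₀ h0] at h4
      rw [sub_nonpos, div_mul_eq_mul_div, le_div_iff₀ hd]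
      linarith
  have hpos : 0 < (Z₀.trace + (Y₁ * σ).trace + (Y₂ * γ').trace).re := by
    rw [hf, Matrix.mul_one, RCLike.re_eq_complex_re] at hf2
    have h1 : Z₀.trace = Y.trace - (u : ℂ) := by
      rw [hZ₀, trace_sub, trace_smul, trace_one, smul_eq_mul]
      congr 1
      rw [← Complex.ofReal_natCast, ← Complex.ofReal_mul, ← hd_def, div_mul_cancel₀ _ hd.ne']
    rw [h1]
    simp only [Complex.add_re, Complex.sub_re, Complex.ofReal_re] at hf2 ⊢
    linarith
  -- Only real parts of traces against Hermitian matrices matter, so adding adjoints merely doubles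
  -- both quantities.
  refine ⟨Z₀ + Z₀ᴴ, Y₁ + Y₁ᴴ, Y₂ + Y₂ᴴ, isHermitian_add_transpose_self _,
    isHermitian_add_transpose_self _, isHermitian_add_transpose_self _, fun N hN hKN => ?_, ?_⟩
  · have hDD : (1 : Matrix a' a' ℂ) ⊗ₖ (Z₀ + Z₀ᴴ) + (Y₁ + Y₁ᴴ)ᵀ ⊗ₖ ρ + (Y₂ + Y₂ᴴ)ᵀ ⊗ₖ γ =
        D + Dᴴ := by
      have hct : ∀ M : Matrix a' a' ℂ, Mᴴᵀ = Mᵀᴴ := fun _ => rfl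
      rw [hD, conjTranspose_add, conjTranspose_add, conjTranspose_kronecker,
        conjTranspose_kronecker, conjTranspose_kronecker, conjTranspose_one, hρ.eq, hγ.eq,
        kronecker_add, transpose_add, transpose_add, add_kronecker, add_kronecker, hct, hct]
      abel
    rw [hDD, add_mul, trace_add, Complex.add_re, re_trace_mul_conjTranspose hN.isHermitian]
    linarith [hneg N hN hKN]
  · have h0 := re_trace_mul_conjTranspose (isHermitian_one (n := a) (α := ℂ)) Z₀
    rw [Matrix.mul_one, Matrix.mul_one] at h0
    rw [trace_add, add_mul, add_mul, trace_add, trace_add]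
    simp only [Complex.add_re] at hpos ⊢
    rw [re_trace_mul_conjTranspose hσ, re_trace_mul_conjTranspose hγ', h0]
    linarith

/-! ### Weak duality -/

/-- The unnormalised maximally entangled vector. -/
def entangledVector (a' : Type v) [DecidableEq a'] : a' × a' → ℂ :=
  fun p => if p.1 = p.2 then 1 else 0

/-- The projection onto the unnormalised maximally entangled vector, up to a scalar. -/
def entangledMatrix (a' : Type v) [DecidableEq a'] : Matrix (a' × a') (a' × a') ℂ :=
  vecMulVec (entangledVector a') (star (entangledVector a'))

omit [Fintype a'] in
theorem entangledMatrix_apply (x y z w : a') :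
    entangledMatrix a' (x, y) (z, w) = if x = y ∧ z = w then 1 else 0 := by
  by_cases h1 : x = y <;> by_cases h2 : z = w <;>
    simp [entangledMatrix, entangledVector, vecMulVec_apply, h1, h2]

/-- For the entangled vector, `HA'` on the second factor acts as `HA'ᵀ` on the first, so the joint
Hamiltonian annihilates it. -/
theorem entangledMatrix_commute (HA' : Matrix a' a' ℂ) :
    jointHamiltonian (-HA'ᵀ) HA' * entangledMatrix a' =
      entangledMatrix a' * jointHamiltonian (-HA'ᵀ) HA' := by
  ext ⟨x, y⟩ ⟨z, w⟩
  rw [jointHamiltonian_mul_apply, mul_jointHamiltonian_apply]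
  simp [entangledMatrix_apply, ite_and]
  split_ifs <;> ring

theorem trace_entangledMatrix_mul_kronecker (η X : Matrix a' a' ℂ) :
    (entangledMatrix a' * (η ⊗ₖ X)).trace = (ηᵀ * X).trace := by
  simp [Matrix.trace, Matrix.mul_apply, Fintype.sum_prod_type, entangledMatrix_apply, ite_and]

/-- Evaluating the operator inequality on the entangled vector turns `1 ⊗ τ` into `Tr τ`. The time
average drops out because the entangled projection is stationary. -/
theorem re_trace_entangledMatrix_mul_le {HA' : Matrix a' a' ℂ} (hHA' : HA'.IsHermitian)
    {ω : Matrix (a' × a') (a' × a') ℂ} {x : ℝ}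
    (hx : x ∈ feasibleTraces (timeAverage (jointHamiltonian (-HA'ᵀ) HA') ω)) :
    (entangledMatrix a' * ω).trace.re ≤ x := by
  obtain ⟨τ, -, h, rfl⟩ := hx
  have h1 := (Complex.le_def.1 (h.dotProduct_mulVec_nonneg (entangledVector a'))).1
  rw [← trace_vecMulVec_star_mul, ← entangledMatrix, mul_sub, trace_sub,
    trace_entangledMatrix_mul_kronecker, transpose_one, Matrix.one_mul,
    trace_mul_timeAverage (jointHamiltonian_isHermitian hHA'.transpose.neg hHA')
      (entangledMatrix_commute HA')] at h1
  simpa using h1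

end Separation

/-! ### Strong duality -/

section Main

variable {a : Type u} {a' : Type v} [Fintype a] [DecidableEq a] [Fintype a'] [DecidableEq a']

theorem one_kronecker_timeAverage {HA : Matrix a a ℂ} {HR : Matrix a' a' ℂ}
    (hHA : HA.IsHermitian) (hHR : HR.IsHermitian) (τ : Matrix a a ℂ) :
    (1 : Matrix a' a' ℂ) ⊗ₖ timeAverage HA τ =
      timeAverage (jointHamiltonian HR HA) ((1 : Matrix a' a' ℂ) ⊗ₖ τ) := by
  refine map_timeAverage hHA (jointHamiltonian_isHermitian hHR hHA)
    (kroneckerBilinear (R := ℂ) (1 : Matrix a' a' ℂ)) (fun Y => ?_) τ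
  change (1 : Matrix a' a' ℂ) ⊗ₖ (HA * Y - Y * HA) =
    jointHamiltonian HR HA * ((1 : Matrix a' a' ℂ) ⊗ₖ Y) -
      ((1 : Matrix a' a' ℂ) ⊗ₖ Y) * jointHamiltonian HR HA
  rw [jointHamiltonian_commutator_kronecker]
  simp

/-- A matrix `τ` with `1 ⊗ τ ≥ ω` on the positive matrices commuting with the Hamiltonian bounds the
infimum in the min-entropy of the time average of `ω`. -/
theorem trace_mem_feasibleTraces [Nonempty a'] {HA : Matrix a a ℂ} {HR : Matrix a' a' ℂ}
    (hHA : HA.IsHermitian) (hHR : HR.IsHermitian) {τ : Matrix a a ℂ} (hτ : τ.IsHermitian)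
    {ω : Matrix (a' × a) (a' × a) ℂ} (hω : ω.PosSemidef)
    (h : ∀ N : Matrix (a' × a) (a' × a) ℂ, N.PosSemidef →
      jointHamiltonian HR HA * N = N * jointHamiltonian HR HA →
      0 ≤ (((1 : Matrix a' a' ℂ) ⊗ₖ τ - ω) * N).trace.re) :
    τ.trace.re ∈ feasibleTraces (timeAverage (jointHamiltonian HR HA) ω) := by
  have hK := jointHamiltonian_isHermitian hHR hHA
  have h1 : ((1 : Matrix a' a' ℂ) ⊗ₖ timeAverage HA τ -
      timeAverage (jointHamiltonian HR HA) ω).PosSemidef := by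
    rw [one_kronecker_timeAverage hHA hHR, ← timeAverage_sub hK]
    have hH : ((1 : Matrix a' a' ℂ) ⊗ₖ τ).IsHermitian := by
      rw [IsHermitian, conjTranspose_kronecker, conjTranspose_one, hτ.eq]
    refine posSemidef_of_trace_mul_nonneg (isHermitian_timeAverage hK (hH.sub hω.isHermitian))
      fun N hN => ?_
    rw [trace_mul_timeAverage_comm hK, trace_mul_comm]
    exact h _ (timeAverage_posSemidef hK hN) (timeAverage_commute hK N)
  refine ⟨timeAverage HA τ, ?_, h1, by rw [trace_timeAverage hHA]⟩
  -- Positivity of the averaged `τ` need not be assumed: `1 ⊗ ⟨τ⟩` dominates the positive `⟨ω⟩`, and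
  -- `⟨τ⟩` is a diagonal block of it.
  have h2 := (h1.add (timeAverage_posSemidef hK hω)).submatrix
    (fun i => (Classical.arbitrary a', i))
  rw [sub_add_cancel] at h2
  convert h2 using 1
  ext
  simp

omit [Fintype a] [DecidableEq a] [Fintype a'] [DecidableEq a'] in
theorem smul_referenceMixture {q t : ℝ} {η₁ η₂ Y₁ Y₂ : Matrix a' a' ℂ}
    (h₁ : ((q * t : ℝ) : ℂ) • η₁ = Y₁) (h₂ : (((1 - q) * t : ℝ) : ℂ) • η₂ = Y₂)
    (ρ γ : Matrix a a ℂ) :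
    (t : ℂ) • referenceMixture q η₁ η₂ ρ γ = Y₁ ⊗ₖ ρ + Y₂ ⊗ₖ γ := by
  rw [← h₁, ← h₂, referenceMixture, smul_kronecker, smul_kronecker, smul_add, smul_smul,
    smul_smul]
  push_cast
  rw [mul_comm (t : ℂ), mul_comm (t : ℂ)]

/-- If all reference entropies increase, there is a thermal process. -/
theorem thermallyConvertible_of_referenceEntropy_le {HA : Matrix a a ℂ} {HA' : Matrix a' a' ℂ}
    (hHA : HA.IsHermitian) (hHA' : HA'.IsHermitian) {β q : ℝ} (hq0 : 0 < q) (hq1 : q < 1)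
    {ρ : Matrix a a ℂ} {σ : Matrix a' a' ℂ} (hρ : IsState ρ) (hσ : IsState σ)
    (h : ∀ η₁ η₂ : Matrix a' a' ℂ, IsState η₁ → IsState η₂ →
      referenceEntropy β q (-HA'ᵀ) HA η₁ η₂ ρ ≤ referenceEntropy β q (-HA'ᵀ) HA' η₁ η₂ σ) :
    ThermallyConvertible β HA HA' ρ σ := by
  have ha := nonempty_of_isState hρ
  have ha' := nonempty_of_isState hσ
  have hγ := gibbsState_isState β hHA
  have hγ' := gibbsState_isState β hHA'
  have hR : (-HA'ᵀ).IsHermitian := hHA'.transpose.neg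
  have hK := jointHamiltonian_isHermitian hR hHA
  have hK' := jointHamiltonian_isHermitian hR hHA'
  by_contra hcon
  obtain ⟨Z, X₁, X₂, hZ, hX₁, hX₂, hneg, hpos⟩ := exists_dual_witness
    (K := jointHamiltonian (-HA'ᵀ) HA) hρ.1.isHermitian hγ.1.isHermitian hσ.1.isHermitian
    hγ'.1.isHermitian (by
      rintro ⟨N, h1, h2, h3, h4, h5⟩
      exact hcon ⟨_, isThermalProcess_ofChoiMatrix hHA hHA' h1 h2 h3 h5, h4⟩)
  -- One scale `t` serves both states, so their weights come out as exactly `q` and `1 - q`.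
  obtain ⟨t, ⟨η₁, s₁, hη₁, e₁⟩, ⟨η₂, s₂, hη₂, e₂⟩, ht⟩ :=
    ((eventually_exists_isState hX₁.transpose hq0).and
      ((eventually_exists_isState hX₂.transpose (sub_pos.2 hq1)).and
        (eventually_gt_atTop 0))).exists
  have ht' : (t : ℂ) ≠ 0 := by exact_mod_cast ht.ne'
  -- Chosen so that `t (1 ⊗ τ - Ω)`, with `Ω` the mixture before averaging, is the negative of the
  -- witness operator; the terms with `s₁` and `s₂` absorb the identity shifts in `η₁` and `η₂`.
  set τ : Matrix a a ℂ :=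
    ((t⁻¹ : ℝ) : ℂ) • (-Z + (s₁ : ℂ) • ρ + (s₂ : ℂ) • gibbsState β HA) with hτ
  have hreal : ∀ (s : ℝ) {X : Matrix a a ℂ}, X.IsHermitian → ((s : ℂ) • X).IsHermitian := by
    intro s X hX
    rw [IsHermitian, conjTranspose_smul, hX.eq]
    simp
  have hτH : τ.IsHermitian :=
    hreal _ ((hZ.neg.add (hreal _ hρ.1.isHermitian)).add (hreal _ hγ.1.isHermitian))
  have htτ : (t : ℂ) • τ = -Z + (s₁ : ℂ) • ρ + (s₂ : ℂ) • gibbsState β HA := by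
    rw [hτ, Complex.ofReal_inv, smul_inv_smul₀ ht']
  have hΩ := referenceMixture_isState hq0 hq1 hη₁ hη₂ hρ hγ
  have hΩ' := referenceMixture_isState hq0 hq1 hη₁ hη₂ hσ hγ'
  have hfeas := trace_mem_feasibleTraces hHA hR hτH hΩ.1 (by
    intro N hN hKN
    refine nonneg_of_mul_nonneg_right (a := t) ?_ ht
    have e : (t : ℂ) • ((1 : Matrix a' a' ℂ) ⊗ₖ τ -
        referenceMixture q η₁ η₂ ρ (gibbsState β HA)) = -((1 : Matrix a' a' ℂ) ⊗ₖ Z +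
        X₁ᵀ ⊗ₖ ρ + X₂ᵀ ⊗ₖ gibbsState β HA) := by
      rw [smul_sub, smul_referenceMixture e₁ e₂, ← kronecker_smul, htτ]
      simp only [kronecker_add, add_kronecker, kronecker_smul, smul_kronecker]
      rw [← neg_one_smul ℂ Z, kronecker_smul, neg_one_smul]
      abel
    rw [← Complex.re_ofReal_mul, ← smul_eq_mul, ← trace_smul, ← Matrix.smul_mul, e,
      Matrix.neg_mul, trace_neg, Complex.neg_re]
    exact neg_nonneg.2 (hneg N hN hKN))
  have hle := (condMinEntropy_le_iff (timeAverage_isState hK hΩ) (timeAverage_isState hK' hΩ')).1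
    (h η₁ η₂ hη₁ hη₂)
  have h1 := hle.trans (csInf_le feasibleTraces_bddBelow hfeas)
  have h2 := le_csInf (feasibleTraces_nonempty (timeAverage_isState hK' hΩ'))
    fun _ => re_trace_entangledMatrix_mul_le hHA'
  -- After scaling by `t`, the shifts contribute `s₁ + s₂` to both sides, since all four states have
  -- trace one. They cancel, and what remains contradicts `hpos`.
  have h3 := mul_le_mul_of_nonneg_left (h2.trans h1) ht.le
  rw [← Complex.re_ofReal_mul, ← Complex.re_ofReal_mul, ← smul_eq_mul, ← trace_smul,
    ← smul_eq_mul (t : ℂ) τ.trace, ← trace_smul, htτ, ← Matrix.mul_smul,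
    smul_referenceMixture e₁ e₂, mul_add, trace_add,
    trace_entangledMatrix_mul_kronecker, trace_entangledMatrix_mul_kronecker] at h3
  simp only [transpose_add, transpose_smul, transpose_transpose, transpose_one, add_mul,
    Matrix.smul_mul, Matrix.one_mul, trace_add, trace_neg, trace_smul, hρ.2, hσ.2, hγ.2, hγ'.2,
    smul_eq_mul, mul_one, Complex.add_re, Complex.neg_re] at h3
  simp only [Complex.add_re] at hpos
  linarith

end Main

end

end QThermo

/-! ### The characterization by reference entropies -/

theorem theorem2 {A : Type u} {A' : Type v}
    [Fintype A] [DecidableEq A] [Fintype A'] [DecidableEq A']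
    (HA : Matrix A A ℂ) (HA' : Matrix A' A' ℂ) (hHA : HA.IsHermitian) (hHA' : HA'.IsHermitian)
    (β : ℝ) (q : ℝ) (hq0 : 0 < q) (hq1 : q < 1)
    (ρ : Matrix A A ℂ) (σ : Matrix A' A' ℂ)
    (hρ : QThermo.IsState ρ) (hσ : QThermo.IsState σ) :
    QThermo.ThermallyConvertible β HA HA' ρ σ ↔
      ∀ (R : Type v) [Fintype R] [DecidableEq R] (e : R ≃ A') (HR : Matrix R R ℂ),
        HR = -(HA'ᵀ).submatrix e e →
        ∀ η₁ η₂ : Matrix R R ℂ, QThermo.IsState η₁ → QThermo.IsState η₂ →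
          QThermo.referenceEntropy β q HR HA η₁ η₂ ρ ≤
            QThermo.referenceEntropy β q HR HA' η₁ η₂ σ := by
  constructor
  · rintro ⟨E, hE, rfl⟩ R _ _ e HR rfl η₁ η₂ h1 h2
    exact hE.referenceEntropy_le hHA hHA' (hHA'.transpose.submatrix e).neg hq0 hq1 h1 h2 hρ
  · intro h
    -- The single reference `R = A'`, with the identity identification of bases, is enough.
    exact QThermo.thermallyConvertible_of_referenceEntropy_le hHA hHA' hq0 hq1 hρ hσ
      (h A' (Equiv.refl A') (-HA'ᵀ) rfl)
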